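/- Let $(\xi_n)_{n\in\mathbb Z}$ be a strictly stationary Markov chain on a probability space $(\Omega,\mathcal F,P)$ with values in a measurable space $(S,\mathcal A)$, with marginal distribution $\pi$ and Markov transition kernel $Q$, that is, for all $n\in\mathbb Z$ and $A\in\mathcal A$, $P(\xi_{n+1}\in A\mid\mathcal F_n)=Q(\xi_n,A)$ almost surely, where $\mathcal F_k=\sigma(\xi_i: i\le k)$. Assume the chain is reversible, i.e. $\int_A Q(x,B)\,\pi(\mathrm dx)=\int_B Q(x,A)\,\pi(\mathrm dx)$ for all $A,B\in\mathcal A$ (equivalently $Q=Q^*$ on $L^2(\pi)$). Let $f\in L^2(\pi)$ be real-valued with $\int f\,\mathrm d\pi=0$, put $X_i=f(\xi_i)$ and $S_n=\sum_{i=0}^{n-1}X_i$, and suppose that $$\lim_{n\to\infty}\frac{\operatorname{var}(S_n)}{n}=\sigma_f^2\quad\text{exists and is finite.}$$ Then there is a sequence $(D_k)_{k\in\mathbb Z}$ of square-integrable random variables, strictly stationary (jointly with $(\xi_k)_{k\in\mathbb Z}$, that is, the process $(\xi_k,D_k)_{k\in\mathbb Z}$ is strictly stationary), such that $M_n=\sum_{i=0}^{n-1}D_i$,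 $n\ge 0$, is a martingale with respect to $(\mathcal F_n)_{n\ge0}$ and $$\frac1n\,\mathbb E\Bigl(\max_{1\le j\le n}(S_j-M_j)^2\Bigr)\longrightarrow 0\qquad(n\to\infty).$$ -/

import Mathlib

open MeasureTheory ProbabilityTheory Filter Topology

/-- A two-sided sequence of random variables `X : ℤ → Ω → E` is (strictly) stationary under `P`:
for every `k`, the shifted sequence `(X (n + k))ₙ` has the same law on `ℤ → E` as `(X n)ₙ`. -/
def IsStationarySeq {Ω E : Type*} {mΩ : MeasurableSpace Ω} [MeasurableSpace E]
    (P : Measure Ω) (X : ℤ → Ω → E) : Prop :=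
  ∀ k : ℤ, IdentDistrib (fun ω (n : ℤ) => X (n + k) ω) (fun ω (n : ℤ) => X n ω) P P

/-- The past of the process: `pastFiltration ξ hξ k` is the σ-algebra generated by
the `ξ i` with `i ≤ k`. -/
def pastFiltration {Ω S : Type*} {mΩ : MeasurableSpace Ω} [mS : MeasurableSpace S]
    (ξ : ℤ → Ω → S) (hξ : ∀ n, Measurable (ξ n)) : Filtration ℤ mΩ where
  seq k := ⨆ i ≤ k, mS.comap (ξ i)
  mono' _ _ hkl := biSup_mono fun _ hi => hi.trans hkl
  le' _ := iSup₂_le fun i _ => (hξ i).comap_le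

/-- The same σ-algebras, restricted to times `n = 0, 1, 2, …`. -/
def pastFiltrationNat {Ω S : Type*} {mΩ : MeasurableSpace Ω} [MeasurableSpace S]
    (ξ : ℤ → Ω → S) (hξ : ∀ n, Measurable (ξ n)) : Filtration ℕ mΩ where
  seq n := pastFiltration ξ hξ (n : ℤ)
  mono' _ _ hmn := (pastFiltration ξ hξ).mono (Int.ofNat_le.mpr hmn)
  le' n := (pastFiltration ξ hξ).le (n : ℤ)

/-- `ξ` is a stationary reversible Markov chain under `P` with marginal distribution `π` and
transition kernel `Q`. Reversibility is detailed balance, i.e. `Q = Q*` on `L²(π)`. -/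
structure IsStationaryReversibleMarkovChain {Ω S : Type*} {mΩ : MeasurableSpace Ω}
    [MeasurableSpace S] (P : Measure Ω) (ξ : ℤ → Ω → S) (hξ : ∀ n, Measurable (ξ n))
    (π : Measure S) (Q : Kernel S S) : Prop where
  stationary : IsStationarySeq P ξ
  marginal : P.map (ξ 0) = π
  markov : ∀ (n : ℤ) (A : Set S), MeasurableSet A →
    P[(ξ (n + 1) ⁻¹' A).indicator (fun _ => (1 : ℝ)) | pastFiltration ξ hξ n]
      =ᵐ[P] fun ω => (Q (ξ n ω)).real A
  reversible : Q.IsReversible π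

/-- The partial sums `∑_{i = 0}^{n - 1} X i` of a two-sided sequence. -/
def partialSum {Ω : Type*} (X : ℤ → Ω → ℝ) (n : ℕ) (ω : Ω) : ℝ :=
  ∑ i ∈ Finset.range n, X (i : ℤ) ω

/-- The maximal martingale approximation of `S_n = ∑_{i<n} X i`: there are square integrable `D k`,
stationary (jointly with `ξ`, so that `D k` is the `k`-th shift of `D 0`), such that
`M_n = ∑_{i<n} D i` is a martingale with respect to the past of `ξ` up to time `n`, and
`E (max_{1 ≤ j ≤ n} (S_j - M_j)²) / n → 0`. -/
def HasMaximalMartingaleApproximation {Ω S : Type*} {mΩ : MeasurableSpace Ω} [MeasurableSpace S]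
    (P : Measure Ω) (ξ : ℤ → Ω → S) (hξ : ∀ n, Measurable (ξ n)) (X : ℤ → Ω → ℝ) : Prop :=
  ∃ D : ℤ → Ω → ℝ,
    (∀ k, MemLp (D k) 2 P) ∧
    IsStationarySeq P (fun k ω => (ξ k ω, D k ω)) ∧
    Martingale (partialSum D) (pastFiltrationNat ξ hξ) P ∧
    Tendsto (fun n : ℕ =>
      (∫ ω, ⨆ j : Finset.Icc 1 n, (partialSum X j ω - partialSum D j ω) ^ 2 ∂P) / (n : ℝ))
      atTop (𝓝 0)

/-! The argument is the Kipnis–Varadhan method, carried out without spectral calculus. Let `T` be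
the transition operator on `L²(π)`, a symmetric contraction, and let E(u) = ⟪u - T u, u⟫ be its
Dirichlet form. Linear growth of the variances forces 2⟪f, u⟫ - E(u) to be bounded above in u, that
is, f has finite dual norm for E (`exists_le_dirichletForm_of_norm_sum_sq_le`). Minimizing E(u) -
2⟪f, u⟫ then gives approximate solutions g_k of the Poisson equation: g_k - T g_k → f in L², and
(g_k) is Cauchy for E, though it need not converge in L²
(`exists_seq_tendsto_sub_of_le_dirichletForm`).

The martingale differences g_k(ξ_{i+1}) - T g_k(ξ_i) have squared norm at most 2 E(g_k), so they
converge in L² of the law of (ξ_0, ξ_1) to some u, and D_i = u(ξ_i, ξ_{i+1}). Writing v_k for the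
k-th difference, S_j - M_j = ∑_{i<j} (f - (g_k - T g_k))(ξ_i) + (g_k(ξ_0) - g_k(ξ_j)) + ∑_{i<j} (v_k
- u)(ξ_i, ξ_{i+1}). The last sum is controlled by Doob's inequality. The boundary term has maximal
square o(n) in mean, by truncation (`exists_maxSq_comp_le`).

The first sum is where reversibility enters a second time. Twice the sum of (g - T g)(ξ_i) is a
forward martingale plus a backward one plus a boundary term, so Doob's inequality bounds its maximum
by a constant times (n + 1) E(g) (`IsTransitionOperator.maxSq_sum_sub_le`). The bound sees only the
Dirichlet form, so it applies to g_l - g_k and passes to the limit in l. The backward martingale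
needs the time-reversed Markov property, which is deduced from detailed balance
(`isTransition_future`). -/

/-! ### Hilbert space: the Dirichlet form and approximate solutions of the Poisson equation. -/

section Hilbert

open scoped InnerProductSpace

variable {H : Type*} [NormedAddCommGroup H] [InnerProductSpace ℝ H]

/-- The Dirichlet form `⟪u - T u, u⟫` of an operator `T`. -/
noncomputable def dirichletForm (T : H →L[ℝ] H) (u : H) : ℝ := ⟪u - T u, u⟫_ℝ

lemma dirichletForm_nonneg {T : H →L[ℝ] H} (hn : ∀ x, ‖T x‖ ≤ ‖x‖) (u : H) :
    0 ≤ dirichletForm T u := by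
  have h1 := real_inner_le_norm (T u) u
  have h2 := mul_le_mul_of_nonneg_right (hn u) (norm_nonneg u)
  rw [dirichletForm, inner_sub_left, real_inner_self_eq_norm_mul_norm]
  linarith

lemma dirichletForm_le {T : H →L[ℝ] H} (hn : ∀ x, ‖T x‖ ≤ ‖x‖) (u : H) :
    dirichletForm T u ≤ 2 * ‖u‖ ^ 2 := by
  have h1 := neg_le_of_abs_le (abs_real_inner_le_norm (T u) u)
  have h2 := mul_le_mul_of_nonneg_right (hn u) (norm_nonneg u)
  rw [dirichletForm, inner_sub_left, real_inner_self_eq_norm_mul_norm]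
  nlinarith

/-- `‖u - T u‖² ≤ 2 ⟪u - T u, u⟫` for a contraction `T`. -/
lemma norm_sub_sq_le_dirichletForm {T : H →L[ℝ] H} (hn : ∀ x, ‖T x‖ ≤ ‖x‖) (u : H) :
    ‖u - T u‖ ^ 2 ≤ 2 * dirichletForm T u := by
  have h1 := norm_sub_sq_real u (T u)
  have h2 : ‖T u‖ ^ 2 ≤ ‖u‖ ^ 2 := by gcongr; exact hn u
  have h3 : dirichletForm T u = ‖u‖ ^ 2 - ⟪u, T u⟫_ℝ := by
    rw [dirichletForm, inner_sub_left, real_inner_self_eq_norm_sq, real_inner_comm]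
  linarith

/-- `‖u‖² - ‖T u‖² ≤ 2 ⟪u - T u, u⟫`. -/
lemma norm_sq_sub_norm_sq_le_dirichletForm (T : H →L[ℝ] H) (u : H) :
    ‖u‖ ^ 2 - ‖T u‖ ^ 2 ≤ 2 * dirichletForm T u := by
  have h1 := norm_sub_sq_real u (T u)
  have h3 : dirichletForm T u = ‖u‖ ^ 2 - ⟪u, T u⟫_ℝ := by
    rw [dirichletForm, inner_sub_left, real_inner_self_eq_norm_sq, real_inner_comm]
  nlinarith [sq_nonneg ‖u - T u‖]

/-- If the linear functional `⟪f, ·⟫` is bounded with respect to the Dirichlet form of a symmetric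
contraction `T`, then `f` is the limit of a sequence `g k - T (g k)`, where `g` is Cauchy for the
Dirichlet form: `g` is a minimizing sequence of `dirichletForm T u - 2 * ⟪f, u⟫`. -/
theorem exists_seq_tendsto_sub_of_le_dirichletForm {T : H →L[ℝ] H}
    (hT : ∀ x y, ⟪T x, y⟫_ℝ = ⟪x, T y⟫_ℝ) (hn : ∀ x, ‖T x‖ ≤ ‖x‖) {f : H} {K : ℝ}
    (hK : ∀ u, 2 * ⟪f, u⟫_ℝ - dirichletForm T u ≤ K) :
    ∃ g : ℕ → H, Tendsto (fun k => g k - T (g k)) atTop (𝓝 f) ∧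
      ∀ ε > 0, ∃ N, ∀ k ≥ N, ∀ l ≥ N, dirichletForm T (g k - g l) ≤ ε := by
  set J : H → ℝ := fun u => dirichletForm T u - 2 * ⟪f, u⟫_ℝ with hJ
  have hbdd : BddBelow (Set.range J) := ⟨-K, by rintro _ ⟨u, rfl⟩; simp only [hJ]; linarith [hK u]⟩
  have hle : ∀ u, (⨅ v, J v) ≤ J u := fun u => ciInf_le hbdd u
  have hex : ∀ k : ℕ, ∃ u, J u < (⨅ v, J v) + 1 / ((k : ℝ) + 1) := fun k =>
    exists_lt_of_ciInf_lt (lt_add_of_pos_right _ Nat.one_div_pos_of_nat)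
  choose g hg using hex
  -- Parallelogram law: the linear part of `J` cancels. Since the midpoint value is at least the
  -- infimum, near-minimizers are close for the Dirichlet form.
  have hpar : ∀ a b : H, dirichletForm T (a - b)
      = 2 * J a + 2 * J b - 4 * J ((1 / 2 : ℝ) • (a + b)) := by
    intro a b
    simp only [hJ, dirichletForm, map_add, map_sub, map_smul, inner_sub_left, inner_sub_right,
      inner_add_left, inner_add_right, inner_smul_left, inner_smul_right]
    simp only [hT, conj_trivial, real_inner_comm b a]
    ring
  have hvar : ∀ a : H, ‖f - (a - T a)‖ ^ 2 / 2 ≤ J a - ⨅ v, J v := by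
    intro a
    set r := f - (a - T a) with hr
    have hf : f = r + (a - T a) := by simp [hr]
    -- Moving by `r / 2` along the residual lowers `J` by at least `‖r‖² / 2`, because
    -- `dirichletForm T r ≤ 2 ‖r‖²`. A near-minimizer therefore has a small residual.
    have h1 : J (a + (1 / 2 : ℝ) • r) = J a - ‖r‖ ^ 2 + dirichletForm T r / 4 := by
      simp only [hJ]
      rw [hf]
      simp only [dirichletForm, map_add, map_smul, inner_sub_left, inner_add_left,
        inner_add_right, inner_smul_left, inner_smul_right, ← real_inner_self_eq_norm_sq]
      simp only [hT, conj_trivial, real_inner_comm r a, real_inner_comm (T r) a]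
      have : ⟪r, T a⟫_ℝ = ⟪a, T r⟫_ℝ := by rw [← hT, real_inner_comm]
      rw [this]
      ring
    have h2 := dirichletForm_le hn r
    have h3 := hle (a + (1 / 2 : ℝ) • r)
    linarith
  have hlim : Tendsto (fun k : ℕ => 1 / ((k : ℝ) + 1)) atTop (𝓝 0) :=
    tendsto_one_div_add_atTop_nhds_zero_nat
  refine ⟨g, ?_, ?_⟩
  · rw [tendsto_iff_norm_sub_tendsto_zero]
    have h2 : Tendsto (fun k => ‖g k - T (g k) - f‖ ^ 2) atTop (𝓝 0) := by
      refine squeeze_zero (fun k => by positivity) (fun k => ?_)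
        (by simpa only [mul_zero] using hlim.const_mul 2)
      rw [norm_sub_rev]
      linarith [hvar (g k), hg k]
    simpa using h2.sqrt
  · intro ε hε
    obtain ⟨N, hN⟩ := (hlim.eventually (gt_mem_nhds (show (0 : ℝ) < ε / 4 by positivity))).exists
    refine ⟨N, fun k hk l hl => ?_⟩
    have hmono : ∀ k ≥ N, 1 / ((k : ℝ) + 1) ≤ 1 / ((N : ℝ) + 1) := fun k hk => by gcongr
    rw [hpar]
    linarith [hle ((1 / 2 : ℝ) • (g k + g l)), hg k, hg l, hmono k hk, hmono l hl]

/-- Linear growth of `‖∑_{i < n} ι i f‖²`, where the isometries `ι i` satisfy the Markov relation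
`⟪ι (i + 1) g, ι j h⟫ = ⟪ι i (T g), ι j h⟫` for `j ≤ i`, bounds the functional `⟪f, ·⟫` with respect
to the Dirichlet form of `T`. -/
theorem exists_le_dirichletForm_of_norm_sum_sq_le {G : Type*} [NormedAddCommGroup G]
    [InnerProductSpace ℝ G] {T : H →L[ℝ] H} (hT : ∀ x y, ⟪T x, y⟫_ℝ = ⟪x, T y⟫_ℝ)
    (hn : ∀ x, ‖T x‖ ≤ ‖x‖) (ι : ℕ → H →ₗᵢ[ℝ] G)
    (hι : ∀ i j, j ≤ i → ∀ g h, ⟪ι (i + 1) g, ι j h⟫_ℝ = ⟪ι i (T g), ι j h⟫_ℝ)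
    {f : H} {C : ℝ} (hC : ∀ n : ℕ, ‖∑ i ∈ Finset.range n, ι i f‖ ^ 2 ≤ C * n) :
    ∃ K, ∀ u, 2 * ⟪f, u⟫_ℝ - dirichletForm T u ≤ K := by
  have hpow : ∀ k j g h, ⟪ι (j + k) g, ι j h⟫_ℝ = ⟪(T ^ k) g, h⟫_ℝ := by
    intro k
    induction k with
    | zero => intro j g h; simp
    | succ k ih =>
      intro j g h
      rw [← add_assoc, hι _ _ (by omega), ih, pow_succ]; rfl
  set S : ℕ → G := fun n => ∑ i ∈ Finset.range n, ι i f with hS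
  set B : ℕ → H := fun n => ∑ k ∈ Finset.range n, (T ^ k) f with hB
  have hTB : ∀ n, T (B n) = B (n + 1) - f := by
    intro n
    simp only [hB, map_sum]
    rw [Finset.sum_range_succ']
    simp [pow_succ']
  have hC0 : 0 ≤ C := by
    have := hC 1
    norm_num at this
    exact (sq_nonneg _).trans this
  -- the norm of `B n`
  have hBn : ∀ n, ‖B n‖ ^ 2 ≤ C * n := by
    intro n
    -- Projecting `S n` to time 0 gives `B n`, hence `‖B n‖ ≤ ‖S n‖`.
    have h1 : ⟪S n, ι 0 (B n)⟫_ℝ = ‖B n‖ ^ 2 := by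
      rw [← real_inner_self_eq_norm_sq]
      nth_rw 2 [hB]
      simp only [hS, sum_inner]
      refine Finset.sum_congr rfl fun i _ => ?_
      simpa using hpow i 0 f (B n)
    have h2 := real_inner_le_norm (S n) (ι 0 (B n))
    rw [h1, LinearIsometry.norm_map] at h2
    have h3 : ‖B n‖ ≤ ‖S n‖ := by
      rcases (norm_nonneg (B n)).eq_or_lt with h | h
      · rw [← h]; positivity
      · nlinarith
    calc ‖B n‖ ^ 2 ≤ ‖S n‖ ^ 2 := by gcongr
      _ ≤ C * n := hC n
  -- the sum of the `⟪f, B m⟫`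
  have hSn : ∀ n, ‖S n‖ ^ 2 = ∑ m ∈ Finset.range n, (2 * ⟪f, B (m + 1)⟫_ℝ - ‖f‖ ^ 2) := by
    intro n
    induction n with
    | zero => simp [hS]
    | succ n ih =>
      rw [Finset.sum_range_succ, ← ih]
      have h1 : S (n + 1) = S n + ι n f := by simp [hS, Finset.sum_range_succ]
      have h2 : ⟪ι n f, S n⟫_ℝ = ⟪f, B (n + 1)⟫_ℝ - ‖f‖ ^ 2 := by
        -- The term at time `n - 1 - i` lies `i + 1` steps before `n` and contributes `⟪T ^ (i + 1)
        -- f, f⟫`.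
        have h3 : ⟪ι n f, S n⟫_ℝ = ⟪T (B n), f⟫_ℝ := by
          simp only [hS, hB, inner_sum, map_sum, sum_inner]
          rw [← Finset.sum_range_reflect]
          refine Finset.sum_congr rfl fun i hi => ?_
          have hi' := Finset.mem_range.1 hi
          have h4 := hpow (i + 1) (n - 1 - i) f f
          rw [show n - 1 - i + (i + 1) = n by omega, pow_succ'] at h4
          exact h4
        rw [h3, hTB, inner_sub_left, real_inner_self_eq_norm_sq, real_inner_comm]
      rw [h1, norm_add_sq_real, real_inner_comm, h2, LinearIsometry.norm_map]
      ring
  -- `V n / n` solves the Poisson equation up to the error `T (B n) / n`, which is O(n^(-1/2)). Its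
  -- Dirichlet form stays bounded because `⟪f, V n⟫` is read off from `‖S n‖²`.
  set V : ℕ → H := fun n => ∑ m ∈ Finset.range n, B (m + 1) with hV
  have hVf : ∀ n, ⟪f, V n⟫_ℝ ≤ (C + ‖f‖ ^ 2) / 2 * n := by
    intro n
    have h1 := hSn n
    rw [Finset.sum_sub_distrib, ← Finset.mul_sum, ← inner_sum] at h1
    have h2 := hC n
    simp only [Finset.sum_const, Finset.card_range, nsmul_eq_mul] at h1
    change ‖S n‖ ^ 2 ≤ _ at h2
    change ‖S n‖ ^ 2 = 2 * ⟪f, V n⟫_ℝ - _ at h1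
    linarith
  have hTV : ∀ n : ℕ, V n - T (V n) = (n : ℝ) • f - T (B n) := by
    intro n
    induction n with
    | zero => simp [hV, hB]
    | succ n ih =>
      have h1 : V (n + 1) = V n + B (n + 1) := by simp [hV, Finset.sum_range_succ]
      have h2 : B (n + 1) = T (B n) + f := by rw [hTB]; abel
      rw [h1, map_add, show V n + B (n + 1) - (T (V n) + T (B (n + 1)))
        = (V n - T (V n)) + B (n + 1) - T (B (n + 1)) by abel, ih, h2]
      push_cast
      rw [add_smul, one_smul]
      abel
  have hBs : ∀ n N : ℕ, n ≤ N → ‖B n‖ ≤ √(C * N) := by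
    intro n N hnN
    refine Real.le_sqrt_of_sq_le ((hBn n).trans ?_)
    gcongr
  have hVn : ∀ n : ℕ, ‖V n‖ ≤ n * √(C * n) := by
    intro n
    refine (norm_sum_le _ _).trans ?_
    refine (Finset.sum_le_card_nsmul _ _ (√(C * n)) fun m hm => hBs _ _ ?_).trans ?_
    · have := Finset.mem_range.1 hm; omega
    · simp
  have hDV : ∀ n : ℕ, dirichletForm T (V n) ≤ (n : ℝ) ^ 2 * ((3 * C + ‖f‖ ^ 2) / 2) := by
    intro n
    rw [dirichletForm, hTV, inner_sub_left, inner_smul_left]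
    have h1 := neg_le_of_abs_le (abs_real_inner_le_norm (T (B n)) (V n))
    have h2 : ‖T (B n)‖ * ‖V n‖ ≤ √(C * n) * (n * √(C * n)) :=
      mul_le_mul ((hn _).trans (hBs n n le_rfl)) (hVn n) (norm_nonneg _) (Real.sqrt_nonneg _)
    have h3 : √(C * n) * (n * √(C * n)) = n * (C * n) := by
      rw [mul_left_comm, Real.mul_self_sqrt (by positivity)]
    have h4 := mul_le_mul_of_nonneg_left (hVf n) (Nat.cast_nonneg (α := ℝ) n)
    simp only [conj_trivial]
    nlinarith
  have hsym : ∀ x y, ⟪x - T x, y⟫_ℝ = ⟪x, y - T y⟫_ℝ := fun x y => by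
    rw [inner_sub_left, inner_sub_right, hT]
  -- Applied to `x = V n / n`, whose image under `1 - T` tends to `f`, this gives the claim as `n →
  -- ∞`.
  have hCS : ∀ x y, 2 * ⟪x - T x, y⟫_ℝ ≤ dirichletForm T x + dirichletForm T y := by
    intro x y
    have h1 := dirichletForm_nonneg hn (x - y)
    have h2 : dirichletForm T (x - y)
        = dirichletForm T x + dirichletForm T y - 2 * ⟪x - T x, y⟫_ℝ := by
      have h3 : ⟪y - T y, x⟫_ℝ = ⟪x - T x, y⟫_ℝ := by rw [hsym x y, real_inner_comm]
      have h4 : x - y - T (x - y) = (x - T x) - (y - T y) := by rw [map_sub]; abel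
      rw [dirichletForm, h4, inner_sub_left, inner_sub_right, inner_sub_right, h3, dirichletForm,
        dirichletForm]
      ring
    linarith
  refine ⟨(3 * C + ‖f‖ ^ 2) / 2, fun u => ?_⟩
  have hlim : Tendsto (fun n : ℕ => (3 * C + ‖f‖ ^ 2) / 2 + 2 * (√(C / n) * ‖u‖)) atTop
      (𝓝 ((3 * C + ‖f‖ ^ 2) / 2 + 2 * (0 * ‖u‖))) := by
    have h1 : Tendsto (fun n : ℕ => √(C / n)) atTop (𝓝 0) := by
      simpa using (tendsto_const_div_atTop_nhds_zero_nat C).sqrt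
    exact ((h1.mul_const _).const_mul _).const_add _
  rw [zero_mul, mul_zero, add_zero] at hlim
  refine ge_of_tendsto hlim ?_
  filter_upwards [eventually_gt_atTop 0] with n hn0
  have hn0' : (0 : ℝ) < n := by exact_mod_cast hn0
  have h1 := hCS ((n : ℝ)⁻¹ • V n) u
  have h2 : dirichletForm T ((n : ℝ)⁻¹ • V n) = (n : ℝ)⁻¹ ^ 2 * dirichletForm T (V n) := by
    rw [dirichletForm, map_smul, ← smul_sub, inner_smul_left, inner_smul_right, dirichletForm]
    simp only [conj_trivial]
    ring
  have h3 : (n : ℝ)⁻¹ • V n - T ((n : ℝ)⁻¹ • V n) = f - (n : ℝ)⁻¹ • T (B n) := by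
    rw [map_smul, ← smul_sub, hTV, smul_sub, smul_smul, inv_mul_cancel₀ hn0'.ne', one_smul]
  have h4 : (n : ℝ)⁻¹ ^ 2 * dirichletForm T (V n) ≤ (3 * C + ‖f‖ ^ 2) / 2 := by
    calc (n : ℝ)⁻¹ ^ 2 * dirichletForm T (V n)
        ≤ (n : ℝ)⁻¹ ^ 2 * ((n : ℝ) ^ 2 * ((3 * C + ‖f‖ ^ 2) / 2)) := by gcongr; exact hDV n
      _ = _ := by field_simp
  have h5 : ⟪(n : ℝ)⁻¹ • T (B n), u⟫_ℝ ≤ √(C / n) * ‖u‖ := by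
    refine (real_inner_le_norm _ _).trans ?_
    gcongr
    rw [norm_smul, Real.norm_of_nonneg (by positivity)]
    refine Real.le_sqrt_of_sq_le ?_
    calc ((n : ℝ)⁻¹ * ‖T (B n)‖) ^ 2 ≤ ((n : ℝ)⁻¹ * ‖B n‖) ^ 2 := by gcongr; exact hn _
      _ = (n : ℝ)⁻¹ ^ 2 * ‖B n‖ ^ 2 := by ring
      _ ≤ (n : ℝ)⁻¹ ^ 2 * (C * n) := by gcongr; exact hBn n
      _ = C / n := by field_simp
  rw [h3, inner_sub_left, h2] at h1
  linarith

end Hilbert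

/-! ### Doob's maximal inequality in `L²`, from a pathwise inequality. -/

section MaximalInequality

open scoped ENNReal

/-- A deterministic form of Doob's `L²` maximal inequality. -/
lemma sq_partialSups_abs_le (s : ℕ → ℝ) (n : ℕ) :
    partialSups (fun j => |s j|) n ^ 2 ≤ 4 * s n ^ 2 - 4 * ∑ k ∈ Finset.range n,
      partialSups (fun j => |s j|) k * (if 0 ≤ s k then 1 else -1) * (s (k + 1) - s k) := by
  set m := partialSups (fun j => |s j|) with hm
  -- When the maximum increases, the new maximum is `|s (n + 1)|`, and the change is absorbed by a
  -- square. The factor 4 then comes from `4 m |s| ≤ m² + 4 s²`.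
  have key : ∀ n, m n ^ 2 - 2 * m n * |s n| + 2 * ∑ k ∈ Finset.range n,
      m k * (if 0 ≤ s k then 1 else -1) * (s (k + 1) - s k) ≤ 0 := by
    intro n
    induction n with
    | zero =>
      simp only [hm, partialSups_zero, Finset.range_zero, Finset.sum_empty]
      nlinarith [sq_nonneg (s 0), sq_abs (s 0)]
    | succ n ih =>
      rw [Finset.sum_range_succ]
      have h0 : 0 ≤ m n := (abs_nonneg (s n)).trans (le_partialSups (fun j => |s j|) n)
      have h1 : (if 0 ≤ s n then 1 else -1) * (s (n + 1) - s n) ≤ |s (n + 1)| - |s n| := by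
        split_ifs with h
        · rw [abs_of_nonneg h]; linarith [le_abs_self (s (n + 1))]
        · rw [abs_of_neg (not_le.1 h)]; linarith [neg_le_abs (s (n + 1))]
      have h2 := mul_le_mul_of_nonneg_left h1 h0
      rw [← mul_assoc] at h2
      have h3 : m (n + 1) = max (m n) |s (n + 1)| := partialSups_add_one _ _
      rcases le_total (m n) |s (n + 1)| with h | h
      · rw [h3, max_eq_right h]
        nlinarith [sq_nonneg (m n - |s (n + 1)|)]
      · rw [h3, max_eq_left h]
        nlinarith
  have h1 := key n
  nlinarith [sq_nonneg (m n - 2 * |s n|), sq_abs (s n)]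

lemma _root_.MeasureTheory.StronglyMeasurable.sup_abs {α : Type*} {m : MeasurableSpace α}
    {f g : α → ℝ} (hf : StronglyMeasurable f) (hg : StronglyMeasurable g) :
    StronglyMeasurable (f ⊔ fun x => |g x|) :=
  hf.sup hg.norm

variable {Ω : Type*} {mΩ : MeasurableSpace Ω} {P : Measure Ω}

lemma integral_mul_eq_zero_of_condExp_eq_zero [IsFiniteMeasure P] {m : MeasurableSpace Ω}
    (hm : m ≤ mΩ) {Z d : Ω → ℝ} (hZm : StronglyMeasurable[m] Z) (hZ : MemLp Z 2 P)
    (hd : MemLp d 2 P) (hcond : P[d | m] =ᵐ[P] 0) : ∫ ω, Z ω * d ω ∂P = 0 := by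
  have h1 : P[Z * d | m] =ᵐ[P] Z * P[d | m] :=
    condExp_mul_of_stronglyMeasurable_left hZm (hZ.integrable_mul hd)
      (hd.integrable one_le_two)
  calc ∫ ω, Z ω * d ω ∂P = ∫ ω, (P[Z * d | m]) ω ∂P := (integral_condExp hm).symm
    _ = ∫ _, 0 ∂P := by
        refine integral_congr_ae ?_
        filter_upwards [h1, hcond] with ω h1 h2
        simp [h1, h2]
    _ = 0 := by simp

/-- The mean of `max_{0 ≤ j ≤ n} Y_j²`. -/
noncomputable def maxSq (P : Measure Ω) (Y : ℕ → Ω → ℝ) (n : ℕ) : ℝ≥0∞ :=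
  ∫⁻ ω, ⨆ j ∈ Finset.range (n + 1), ‖Y j ω‖ₑ ^ 2 ∂P

lemma maxSq_le_of_ae_le {Y : ℕ → Ω → ℝ} {n : ℕ} {G : Ω → ℝ≥0∞}
    (h : ∀ᵐ ω ∂P, ∀ j ≤ n, ‖Y j ω‖ₑ ^ 2 ≤ G ω) : maxSq P Y n ≤ ∫⁻ ω, G ω ∂P := by
  refine lintegral_mono_ae ?_
  filter_upwards [h] with ω hω
  exact iSup₂_le fun j hj => hω j (Nat.lt_succ_iff.1 (Finset.mem_range.1 hj))

lemma enorm_sq_le_iSup {Y : ℕ → Ω → ℝ} {j n : ℕ} (hj : j ≤ n) (ω : Ω) :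
    ‖Y j ω‖ₑ ^ 2 ≤ ⨆ j ∈ Finset.range (n + 1), ‖Y j ω‖ₑ ^ 2 :=
  le_iSup₂ (f := fun j (_ : j ∈ Finset.range (n + 1)) => ‖Y j ω‖ₑ ^ 2) j
    (Finset.mem_range.2 (Nat.lt_succ_iff.2 hj))

lemma enorm_add_sq_le (a b : ℝ) : ‖a + b‖ₑ ^ 2 ≤ 2 * ‖a‖ₑ ^ 2 + 2 * ‖b‖ₑ ^ 2 := by
  have h : (a + b) ^ 2 ≤ 2 * a ^ 2 + 2 * b ^ 2 := by nlinarith [sq_nonneg (a - b)]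
  have h2 := ENNReal.ofReal_le_ofReal h
  rw [ENNReal.ofReal_add (by positivity) (by positivity), ENNReal.ofReal_mul (by norm_num),
    ENNReal.ofReal_mul (by norm_num)] at h2
  have h3 : ∀ x : ℝ, ‖x‖ₑ ^ 2 = ENNReal.ofReal (x ^ 2) := fun x => by
    rw [← sq_abs, ENNReal.ofReal_pow (abs_nonneg x), Real.enorm_eq_ofReal_abs]
  simpa [h3] using h2

lemma aemeasurable_iSup_enorm_sq {Y : ℕ → Ω → ℝ} (hY : ∀ j, AEMeasurable (Y j) P) (n : ℕ) :
    AEMeasurable (fun ω => ⨆ j ∈ Finset.range (n + 1), ‖Y j ω‖ₑ ^ 2) P :=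
  AEMeasurable.biSup _ (Finset.range (n + 1)).countable_toSet fun j _ => (hY j).enorm.pow_const 2

lemma maxSq_add_le {Y Z W : ℕ → Ω → ℝ} (hY : ∀ j, AEMeasurable (Y j) P) {n : ℕ}
    (h : ∀ᵐ ω ∂P, ∀ j ≤ n, W j ω = Y j ω + Z j ω) :
    maxSq P W n ≤ 2 * maxSq P Y n + 2 * maxSq P Z n := by
  unfold maxSq
  rw [← lintegral_const_mul' _ _ (by norm_num),
    ← lintegral_const_mul' _ _ (by norm_num),
    ← lintegral_add_left' ((aemeasurable_iSup_enorm_sq hY n).const_mul _)]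
  refine maxSq_le_of_ae_le ?_
  filter_upwards [h] with ω hω j hj
  rw [hω j hj]
  refine (enorm_add_sq_le _ _).trans ?_
  gcongr
  · exact enorm_sq_le_iSup hj ω
  · exact enorm_sq_le_iSup hj ω

lemma maxSq_le_sum {Y : ℕ → Ω → ℝ} (hY : ∀ j, AEMeasurable (Y j) P) (n : ℕ) :
    maxSq P Y n ≤ ∑ j ∈ Finset.range (n + 1), ∫⁻ ω, ‖Y j ω‖ₑ ^ 2 ∂P := by
  rw [← lintegral_finsetSum' _ fun j _ => (hY j).enorm.pow_const 2]
  refine maxSq_le_of_ae_le (ae_of_all _ fun ω j hj => ?_)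
  exact Finset.single_le_sum (f := fun j => ‖Y j ω‖ₑ ^ 2) (fun _ _ => zero_le)
    (Finset.mem_range.2 (Nat.lt_succ_iff.2 hj))

lemma lintegral_enorm_sq_eq_ofReal {Y : Ω → ℝ} (hY : MemLp Y 2 P) :
    ∫⁻ ω, ‖Y ω‖ₑ ^ 2 ∂P = ENNReal.ofReal (∫ ω, Y ω ^ 2 ∂P) := by
  rw [ofReal_integral_eq_lintegral_ofReal hY.integrable_sq (ae_of_all _ fun ω => sq_nonneg _)]
  refine lintegral_congr fun ω => ?_
  rw [← sq_abs, ENNReal.ofReal_pow (abs_nonneg _), Real.enorm_eq_ofReal_abs]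

/-- Doob's `L²` maximal inequality for the partial sums of martingale differences. -/
theorem maxSq_sum_le [IsFiniteMeasure P] (F : Filtration ℕ mΩ) {d : ℕ → Ω → ℝ} {n : ℕ}
    (hd : ∀ k < n, MemLp (d k) 2 P) (hdm : ∀ k < n, StronglyMeasurable[F (k + 1)] (d k))
    (hcond : ∀ k < n, P[d k | F k] =ᵐ[P] 0) {c : ℝ} (hc : ∀ k < n, ∫ ω, d k ω ^ 2 ∂P ≤ c) :
    maxSq P (fun j ω => ∑ i ∈ Finset.range j, d i ω) n ≤ ENNReal.ofReal (4 * (n * c)) := by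
  set s : ℕ → Ω → ℝ := fun j ω => ∑ i ∈ Finset.range j, d i ω with hs
  set M : ℕ → Ω → ℝ := fun j ω => partialSups (fun i => |s i ω|) j with hM
  have hs2 : ∀ j ≤ n, MemLp (s j) 2 P := fun j hj =>
    memLp_finsetSum _ fun i hi => hd i ((Finset.mem_range.1 hi).trans_le hj)
  have hsm : ∀ j ≤ n, StronglyMeasurable[F j] (s j) := fun j hj =>
    Finset.stronglyMeasurable_fun_sum _ fun i hi =>
      (hdm i ((Finset.mem_range.1 hi).trans_le hj)).mono (F.mono (Finset.mem_range.1 hi))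
  have hMs : ∀ j, M (j + 1) = M j ⊔ fun ω => |s (j + 1) ω| := fun j => by
    ext ω; exact partialSups_add_one _ _
  have hM2 : ∀ j ≤ n, MemLp (M j) 2 P := by
    intro j
    induction j with
    | zero =>
      intro h
      have : M 0 = |s 0| := by ext ω; simp [hM]
      rw [this]
      exact (hs2 0 h).abs
    | succ j ih => intro h; rw [hMs]; exact (ih (by omega)).sup (hs2 _ h).abs
  have hMm : ∀ j ≤ n, StronglyMeasurable[F j] (M j) := by
    intro j
    induction j with
    | zero =>
      intro h
      have : M 0 = fun _ => 0 := by ext ω; simp [hM, hs]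
      rw [this]; exact stronglyMeasurable_const
    | succ j ih =>
      intro h
      rw [hMs]
      exact ((ih (by omega)).mono (F.mono (Nat.le_succ j))).sup_abs (hsm _ h)
  have hstep : ∀ j ω, s (j + 1) ω - s j ω = d j ω := fun j ω => by
    simp [hs, Finset.sum_range_succ]
  have hZm : ∀ k < n, StronglyMeasurable[F k]
      (fun ω => M k ω * (if 0 ≤ s k ω then 1 else -1)) := fun k hk =>
    (hMm k hk.le).mul (StronglyMeasurable.ite
      (measurableSet_le measurable_const (hsm k hk.le).measurable)
      stronglyMeasurable_const stronglyMeasurable_const)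
  have hZ2 : ∀ k < n, MemLp (fun ω => M k ω * (if 0 ≤ s k ω then 1 else -1)) 2 P :=
    fun k hk => (hM2 k hk.le).mono ((hZm k hk).mono (F.le k)).aestronglyMeasurable
      (ae_of_all _ fun ω => by split_ifs <;> simp)
  -- The weight is known at time `k`, so the correction sum in the pathwise inequality has mean
  -- zero.
  have hort : ∀ k < n, ∫ ω, M k ω * (if 0 ≤ s k ω then 1 else -1) * (s (k + 1) ω - s k ω) ∂P
      = 0 := fun k hk => by
    simp_rw [hstep]
    exact integral_mul_eq_zero_of_condExp_eq_zero (F.le k) (hZm k hk) (hZ2 k hk) (hd k hk)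
      (hcond k hk)
  have hsq : ∀ j ≤ n, ∫ ω, s j ω ^ 2 ∂P ≤ j * c := by
    intro j
    induction j with
    | zero => intro _; simp [hs]
    | succ j ih =>
      intro hj
      have h1 : ∫ ω, s j ω * d j ω ∂P = 0 :=
        integral_mul_eq_zero_of_condExp_eq_zero (F.le j) (hsm j (by omega)) (hs2 j (by omega))
          (hd j hj) (hcond j hj)
      have h2 : ∀ ω, s (j + 1) ω ^ 2 = s j ω ^ 2 + 2 * (s j ω * d j ω) + d j ω ^ 2 := fun ω => by
        rw [← hstep j ω]; ring
      have i1 := (hs2 j (by omega)).integrable_sq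
      have i2 := ((hs2 j (by omega)).integrable_mul (hd j hj)).const_mul 2
      have i3 := (hd j hj).integrable_sq
      simp only [Pi.mul_apply] at i2
      simp_rw [h2]
      rw [integral_add (f := fun ω => s j ω ^ 2 + 2 * (s j ω * d j ω)) (i1.add i2) i3,
        integral_add i1 i2, integral_const_mul, h1]
      push_cast
      linarith [ih (by omega), hc j hj]
  calc maxSq P s n ≤ ∫⁻ ω, ENNReal.ofReal (M n ω ^ 2) ∂P := by
        refine maxSq_le_of_ae_le (ae_of_all _ fun ω j hj => ?_)
        rw [Real.enorm_eq_ofReal_abs, ← ENNReal.ofReal_pow (abs_nonneg _)]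
        refine ENNReal.ofReal_le_ofReal ?_
        gcongr
        exact le_partialSups_of_le (fun i => |s i ω|) hj
    _ = ENNReal.ofReal (∫ ω, M n ω ^ 2 ∂P) :=
        (ofReal_integral_eq_lintegral_ofReal (hM2 n le_rfl).integrable_sq
          (ae_of_all _ fun ω => sq_nonneg _)).symm
    _ ≤ ENNReal.ofReal (4 * (n * c)) := by
        refine ENNReal.ofReal_le_ofReal ?_
        have hi : ∀ k ∈ Finset.range n, Integrable
            (fun ω => M k ω * (if 0 ≤ s k ω then 1 else -1) * (s (k + 1) ω - s k ω)) P :=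
          fun k hk => by
            simp_rw [hstep]
            exact (hZ2 k (Finset.mem_range.1 hk)).integrable_mul (hd k (Finset.mem_range.1 hk))
        have i1 := ((hs2 n le_rfl).integrable_sq).const_mul 4
        have i2 := (integrable_finsetSum _ hi).const_mul 4
        calc ∫ ω, M n ω ^ 2 ∂P ≤ ∫ ω, (4 * s n ω ^ 2 - 4 * ∑ k ∈ Finset.range n,
              M k ω * (if 0 ≤ s k ω then 1 else -1) * (s (k + 1) ω - s k ω)) ∂P :=
              integral_mono (hM2 n le_rfl).integrable_sq (i1.sub i2)
                fun ω => sq_partialSups_abs_le (fun j => s j ω) n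
          _ = 4 * ∫ ω, s n ω ^ 2 ∂P := by
              rw [integral_sub i1 i2, integral_const_mul, integral_const_mul,
                integral_finsetSum _ hi,
                Finset.sum_eq_zero fun k hk => hort k (Finset.mem_range.1 hk)]
              simp
          _ ≤ 4 * (n * c) := by linarith [hsq n le_rfl]

end MaximalInequality

/-! ### The Markov property and its time reversal. -/

section Transition

open scoped ENNReal

variable {Ω S : Type*} {m : MeasurableSpace Ω} {mΩ : MeasurableSpace Ω} [mS : MeasurableSpace S] {P : Measure Ω}
  {Q : Kernel S S}

/-- Given the σ-algebra `m`, the conditional law of `Y` is `Q (W ·)`. -/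
def IsTransition (P : Measure Ω) (Q : Kernel S S) (m : MeasurableSpace Ω) (Y W : Ω → S) : Prop :=
  ∀ A, MeasurableSet[m] A → ∀ B, MeasurableSet B → P (A ∩ Y ⁻¹' B) = ∫⁻ ω in A, Q (W ω) B ∂P

namespace IsTransition

variable {Y W : Ω → S}

lemma map_restrict (h : IsTransition P Q m Y W) (hY : Measurable Y)
    (hW : Measurable W) {A : Set Ω} (hA : MeasurableSet[m] A) :
    (P.restrict A).map Y = Q ∘ₘ ((P.restrict A).map W) := by
  ext B hB
  rw [Measure.map_apply hY hB, Measure.restrict_apply (hY hB), Set.inter_comm, h A hA B hB,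
    Measure.bind_apply hB Q.aemeasurable, lintegral_map (Q.measurable_coe hB) hW]

/-- For an indicator `Z` this is the identity of image measures `map_restrict`; general `Z` follows
by linearity and monotone convergence. -/
lemma lintegral_mul (h : IsTransition P Q m Y W) (hm : m ≤ mΩ) (hY : Measurable Y)
    (hW : Measurable W) {Z : Ω → ℝ≥0∞} (hZ : Measurable[m] Z) {g : S → ℝ≥0∞}
    (hg : Measurable g) :
    ∫⁻ ω, Z ω * g (Y ω) ∂P = ∫⁻ ω, Z ω * ∫⁻ y, g y ∂Q (W ω) ∂P := by
  have hK : Measurable fun ω => ∫⁻ y, g y ∂Q (W ω) := hg.lintegral_kernel.comp hW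
  have hgY : Measurable fun ω => g (Y ω) := hg.comp hY
  have hmul : ∀ {f u : Ω → ℝ≥0∞}, Measurable[m] f → Measurable u →
      Measurable fun ω => f ω * u ω := fun hf hu => (hf.mono hm le_rfl).mul hu
  refine @Measurable.ennreal_induction Ω m
    (fun Z => ∫⁻ ω, Z ω * g (Y ω) ∂P = ∫⁻ ω, Z ω * ∫⁻ y, g y ∂Q (W ω) ∂P) ?_ ?_ ?_ Z hZ
  · intro c s hs
    have h1 : ∀ u : Ω → ℝ≥0∞, (fun ω => s.indicator (fun _ => c) ω * u ω)
        = s.indicator fun ω => c * u ω := fun u => by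
      ext ω; by_cases hω : ω ∈ s <;> simp [hω]
    rw [h1 fun ω => g (Y ω), h1 fun ω => ∫⁻ y, g y ∂Q (W ω), lintegral_indicator (hm _ hs),
      lintegral_indicator (hm _ hs), lintegral_const_mul _ hgY, lintegral_const_mul _ hK,
      ← lintegral_map hg hY, h.map_restrict hY hW hs,
      Measure.lintegral_bind Q.aemeasurable hg.aemeasurable,
      lintegral_map hg.lintegral_kernel hW]
  · intro f₁ f₂ _ hf₁ hf₂ h₁ h₂
    simp only [Pi.add_apply, add_mul]
    rw [lintegral_add_left (hmul hf₁ hgY), h₁, h₂,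
      lintegral_add_left (hmul hf₁ hK)]
  · intro f hf hmono ih
    simp only [ENNReal.iSup_mul]
    rw [lintegral_iSup (fun n => hmul (hf n) hgY)
        (fun i j hij ω => mul_le_mul_left (hmono hij ω) _),
      lintegral_iSup (fun n => hmul (hf n) hK)
        (fun i j hij ω => mul_le_mul_left (hmono hij ω) _)]
    simp only [ih]

lemma condExp_ae_eq [IsFiniteMeasure P] [IsSFiniteKernel Q] (h : IsTransition P Q m Y W)
    (hm : m ≤ mΩ)
    (hY : Measurable Y) (hW : Measurable[m] W) {g : S → ℝ} (hg : StronglyMeasurable g)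
    (hgi : Integrable (fun ω => g (Y ω)) P) :
    P[fun ω => g (Y ω) | m] =ᵐ[P] fun ω => ∫ y, g y ∂Q (W ω) := by
  have hW' : Measurable W := hW.mono hm le_rfl
  have hK : StronglyMeasurable fun x => ∫ y, g y ∂Q x := hg.integral_kernel
  have hint : ∀ A, MeasurableSet[m] A → Integrable g (Q ∘ₘ ((P.restrict A).map W)) := by
    intro A hA
    rw [← h.map_restrict hY hW' hA]
    exact (integrable_map_measure hg.aestronglyMeasurable hY.aemeasurable).2 hgi.restrict
  refine (ae_eq_condExp_of_forall_setIntegral_eq hm hgi (fun A hA _ => ?_) (fun A hA _ => ?_)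
    (hK.comp_measurable hW).aestronglyMeasurable).symm
  · have h1 := hint A hA
    rw [Measure.comp_eq_comp_const_apply] at h1
    have h2 := h1.integral_comp
    rw [Kernel.const_apply] at h2
    exact h2.comp_measurable hW'
  · have h1 := hint A hA
    rw [Measure.comp_eq_comp_const_apply] at h1
    have h2 := Kernel.integral_comp h1
    rw [Kernel.const_apply, ← Measure.comp_eq_comp_const_apply, ← h.map_restrict hY hW' hA,
      integral_map hY.aemeasurable hg.aestronglyMeasurable,
      integral_map hW'.aemeasurable hK.aestronglyMeasurable] at h2
    exact h2.symm

end IsTransition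

variable {ξ : ℤ → Ω → S} {hξ : ∀ n, Measurable (ξ n)} {π : Measure S}

/-- The σ-algebra generated by the `ξ i` with `n ≤ i`. -/
@[reducible]
def futureSigma (ξ : ℤ → Ω → S) (n : ℤ) : MeasurableSpace Ω :=
  ⨆ i ∈ Set.Ici n, mS.comap (ξ i)

lemma futureSigma_le (hξ : ∀ n, Measurable (ξ n)) (n : ℤ) : futureSigma ξ n ≤ mΩ :=
  iSup₂_le fun i _ => (hξ i).comap_le

lemma futureSigma_anti (ξ : ℤ → Ω → S) {k n : ℤ} (h : k ≤ n) :
    futureSigma ξ n ≤ futureSigma ξ k :=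
  biSup_mono fun _ hi => h.trans hi

lemma measurable_futureSigma (ξ : ℤ → Ω → S) {i n : ℤ} (h : n ≤ i) :
    Measurable[futureSigma ξ n] (ξ i) :=
  measurable_iff_comap_le.2 (le_iSup₂ (f := fun i (_ : i ∈ Set.Ici n) => mS.comap (ξ i)) i h)

lemma measurable_pastFiltration (hξ : ∀ n, Measurable (ξ n)) {i n : ℤ} (h : i ≤ n) :
    Measurable[pastFiltration ξ hξ n] (ξ i) :=
  measurable_iff_comap_le.2 (le_iSup₂ (f := fun i (_ : i ≤ n) => mS.comap (ξ i)) i h)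

namespace IsStationaryReversibleMarkovChain

lemma measurePreserving (hc : IsStationaryReversibleMarkovChain P ξ hξ π Q) (n : ℤ) :
    MeasurePreserving (ξ n) P π := by
  refine ⟨hξ n, ?_⟩
  have h1 := ((hc.stationary n).comp (measurable_pi_apply (0 : ℤ))).map_eq
  rw [← hc.marginal]
  simpa [Function.comp_def] using h1

lemma isTransition_past [IsFiniteMeasure P] [IsMarkovKernel Q]
    (hc : IsStationaryReversibleMarkovChain P ξ hξ π Q) (n : ℤ) :
    IsTransition P Q (pastFiltration ξ hξ n) (ξ (n + 1)) (ξ n) := by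
  intro A hA B hB
  have hm := (pastFiltration ξ hξ).le n
  have hYB := hξ (n + 1) hB
  have h1 : ∫ ω in A, (ξ (n + 1) ⁻¹' B).indicator (fun _ => (1 : ℝ)) ω ∂P
      = ∫ ω in A, (Q (ξ n ω)).real B ∂P := by
    rw [← setIntegral_condExp hm ((integrable_const 1).indicator hYB) hA]
    exact setIntegral_congr_ae (hm _ hA) ((hc.markov n B hB).mono fun _ h _ => h)
  have hmeas : Measurable fun ω => (Q (ξ n ω)).real B :=
    ((Q.measurable_coe hB).comp (hξ n)).ennreal_toReal
  have h2 : Integrable (fun ω => (Q (ξ n ω)).real B) (P.restrict A) :=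
    Integrable.of_bound hmeas.aestronglyMeasurable 1
      (ae_of_all _ fun ω => by
        rw [Real.norm_of_nonneg measureReal_nonneg]; exact measureReal_le_one)
  have h3 := congrArg ENNReal.ofReal h1
  rw [ofReal_integral_eq_lintegral_ofReal h2 (ae_of_all _ fun _ => measureReal_nonneg),
    integral_indicator_const _ hYB] at h3
  simpa [measureReal_restrict_apply hYB, Set.inter_comm] using h3

/-- Both sides become integrals against `π`, and detailed balance exchanges the two sets. Only the
single state `ξ (n + 1)` is conditioned on here; this is the base case for the whole future. -/
lemma isTransition_comap [IsFiniteMeasure P] [IsMarkovKernel Q]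
    (hc : IsStationaryReversibleMarkovChain P ξ hξ π Q) (n : ℤ) :
    IsTransition P Q (mS.comap (ξ (n + 1))) (ξ n) (ξ (n + 1)) := by
  rintro _ ⟨C, hC, rfl⟩ B hB
  have h1 := hc.isTransition_past n (ξ n ⁻¹' B) (measurable_pastFiltration hξ le_rfl hB) C hC
  rw [Set.inter_comm, h1,
    (hc.measurePreserving n).setLIntegral_comp_preimage hB (Q.measurable_coe hC),
    (hc.measurePreserving (n + 1)).setLIntegral_comp_preimage hC (Q.measurable_coe hB)]
  exact hc.reversible hB hC

/-- Detailed balance along the path: `ξ n` may be replaced by one step of `Q` from `ξ (n + 1)`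
in the presence of functions of finitely many `ξ i`, `i > n`. -/
lemma lintegral_prod_mul [IsFiniteMeasure P] [IsMarkovKernel Q]
    (hc : IsStationaryReversibleMarkovChain P ξ hξ π Q) (n : ℤ) {g : S → ℝ≥0∞}
    (hg : Measurable g) (N : ℕ) (h : ℕ → S → ℝ≥0∞) (hh : ∀ i, Measurable (h i)) :
    ∫⁻ ω, (∏ i ∈ Finset.range (N + 1), h i (ξ (n + 1 + (i : ℤ)) ω)) * g (ξ n ω) ∂P
      = ∫⁻ ω, (∏ i ∈ Finset.range (N + 1), h i (ξ (n + 1 + (i : ℤ)) ω))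
        * ∫⁻ y, g y ∂Q (ξ (n + 1) ω) ∂P := by
  induction N generalizing h with
  | zero =>
    have h1 := (hc.isTransition_comap n).lintegral_mul (hξ (n + 1)).comap_le (hξ n) (hξ (n + 1))
      ((hh 0).comp (comap_measurable (ξ (n + 1)))) hg
    simpa using h1
  | succ N ih =>
    set k : ℤ := n + 1 + (N : ℤ) with hk
    -- The forward Markov property integrates out the last state and absorbs its factor into the
    -- preceding one. This applies to both sides of the identity, since the remaining factor `R` is
    -- measurable with respect to the past of `k`.
    set h' : ℕ → S → ℝ≥0∞ := fun i =>
      if i = N then fun x => h N x * ∫⁻ y, h (N + 1) y ∂Q x else h i with hh'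
    have hm' : ∀ i, Measurable (h' i) := by
      intro i
      simp only [hh']
      split_ifs
      · exact (hh N).mul (hh (N + 1)).lintegral_kernel
      · exact hh i
    have key : ∀ R : Ω → ℝ≥0∞, Measurable[pastFiltration ξ hξ k] R →
        ∫⁻ ω, (∏ i ∈ Finset.range (N + 1 + 1), h i (ξ (n + 1 + (i : ℤ)) ω)) * R ω ∂P
        = ∫⁻ ω, (∏ i ∈ Finset.range (N + 1), h' i (ξ (n + 1 + (i : ℤ)) ω)) * R ω ∂P := by
      intro R hR
      have h1 := (hc.isTransition_past k).lintegral_mul ((pastFiltration ξ hξ).le k)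
        (hξ (k + 1)) (hξ k)
        (Z := fun ω => (∏ i ∈ Finset.range (N + 1), h i (ξ (n + 1 + (i : ℤ)) ω)) * R ω)
        (Measurable.mul (Finset.measurable_fun_prod _ fun i hi => (hh i).comp
          (measurable_pastFiltration hξ (by have := Finset.mem_range.1 hi; omega))) hR)
        (hh (N + 1))
      convert h1 using 2
      · ext ω
        rw [Finset.prod_range_succ, show n + 1 + ((N + 1 : ℕ) : ℤ) = k + 1 by push_cast; omega]
        ring
      · ext ω
        rw [Finset.prod_range_succ, Finset.prod_range_succ (n := N)]
        have h2 : ∏ i ∈ Finset.range N, h' i (ξ (n + 1 + (i : ℤ)) ω)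
            = ∏ i ∈ Finset.range N, h i (ξ (n + 1 + (i : ℤ)) ω) :=
          Finset.prod_congr rfl fun i hi => by
            simp only [hh', if_neg (Finset.mem_range.1 hi).ne]
        rw [h2]
        simp only [hh', if_true, ← hk]
        ring
    rw [key (fun ω => g (ξ n ω)) (hg.comp (measurable_pastFiltration hξ (by omega))), ih h' hm',
      key (fun ω => ∫⁻ y, g y ∂Q (ξ (n + 1) ω))
        (hg.lintegral_kernel.comp (measurable_pastFiltration hξ (by omega)))]

/-- The time-reversed Markov property of a reversible chain. -/
lemma isTransition_future [IsFiniteMeasure P] [IsMarkovKernel Q]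
    (hc : IsStationaryReversibleMarkovChain P ξ hξ π Q) (n : ℤ) :
    IsTransition P Q (futureSigma ξ (n + 1)) (ξ n) (ξ (n + 1)) := by
  intro A hA B hB
  have hm := futureSigma_le hξ (n + 1)
  -- Finite-dimensional cylinders form a π-system generating the future, so two finite measures need
  -- only be compared there.
  set C := piiUnionInter (fun i => {s | MeasurableSet[mS.comap (ξ i)] s}) (Set.Ici (n + 1)) with hC
  have hCm : ∀ s ∈ C, MeasurableSet s := fun s hs =>
    hm _ (measurableSet_iSup_of_mem_piiUnionInter (fun i => mS.comap (ξ i)) _ s hs)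
  have key : ∀ s ∈ C, P.restrict (ξ n ⁻¹' B) s
      = P.withDensity (fun ω => Q (ξ (n + 1) ω) B) s := by
    intro s hs
    have hsm := hCm s hs
    obtain ⟨t, ht, f, hf, rfl⟩ := hs
    have hD : ∀ i, ∃ D, MeasurableSet D ∧ (i ∈ t → ξ i ⁻¹' D = f i) := by
      intro i
      by_cases hi : i ∈ t
      · obtain ⟨D, hD, hDf⟩ := hf i hi
        exact ⟨D, hD, fun _ => hDf⟩
      · exact ⟨Set.univ, .univ, fun h => (hi h).elim⟩
    choose D hDm hDf using hD
    -- Any bound on the offsets of the indices in `t` would do; times outside `t` receive the factor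
    -- 1.
    set N : ℕ := ∑ i ∈ t, (i - (n + 1)).toNat with hN
    have hiN : ∀ i ∈ t, (i - (n + 1)).toNat ≤ N := fun i hi =>
      Finset.single_le_sum (f := fun i : ℤ => (i - (n + 1)).toNat) (fun _ _ => Nat.zero_le _) hi
    set h : ℕ → S → ℝ≥0∞ := fun i => if (n + 1 + (i : ℤ)) ∈ t then
      (D (n + 1 + (i : ℤ))).indicator (fun _ => 1) else fun _ => 1 with hh
    have hprod : ∀ ω, ∏ i ∈ Finset.range (N + 1), h i (ξ (n + 1 + (i : ℤ)) ω)
        = (⋂ x ∈ t, f x).indicator (fun _ => 1) ω := by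
      intro ω
      by_cases hω : ω ∈ ⋂ x ∈ t, f x
      · rw [Set.indicator_of_mem hω]
        refine Finset.prod_eq_one fun i _ => ?_
        simp only [hh]
        split_ifs with hi
        · have h1 := Set.mem_iInter₂.1 hω _ hi
          rw [← hDf _ hi] at h1
          exact Set.indicator_of_mem (show ξ _ ω ∈ D _ from h1) fun _ => (1 : ℝ≥0∞)
        · rfl
      · rw [Set.indicator_of_notMem hω]
        simp only [Set.mem_iInter, not_forall] at hω
        obtain ⟨x, hx, hωx⟩ := hω
        have hxn : n + 1 ≤ x := ht hx
        refine Finset.prod_eq_zero (i := (x - (n + 1)).toNat)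
          (Finset.mem_range.2 (Nat.lt_succ_of_le (hiN x hx))) ?_
        have hx' : n + 1 + (((x - (n + 1)).toNat : ℕ) : ℤ) = x := by omega
        simp only [hh, hx', if_pos hx]
        refine Set.indicator_of_notMem (fun h1 => hωx ?_) _
        rw [← hDf x hx]
        exact h1
    have h1 := hc.lintegral_prod_mul n (g := B.indicator fun _ => 1)
      (measurable_const.indicator hB) N h (fun i => by
        simp only [hh]
        split_ifs
        · exact measurable_const.indicator (hDm _)
        · exact measurable_const)
    simp only [hprod, lintegral_indicator_const hB, one_mul] at h1
    have h2 : ∀ u : Ω → ℝ≥0∞, (fun ω => (⋂ x ∈ t, f x).indicator (fun _ => 1) ω * u ω)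
        = (⋂ x ∈ t, f x).indicator u := fun u => by
      ext ω; by_cases hω : ω ∈ ⋂ x ∈ t, f x <;> simp [hω]
    rw [h2 fun ω => B.indicator (fun _ => 1) (ξ n ω), h2 fun ω => Q (ξ (n + 1) ω) B,
      lintegral_indicator hsm, lintegral_indicator hsm] at h1
    rw [withDensity_apply _ hsm, ← h1, Measure.restrict_apply hsm]
    change _ = ∫⁻ ω in ⋂ x ∈ t, f x, (ξ n ⁻¹' B).indicator (fun _ => 1) ω ∂P
    rw [lintegral_indicator_const (hξ n hB), one_mul, Measure.restrict_apply (hξ n hB),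
      Set.inter_comm]
  have huniv : Set.univ ∈ C := ⟨∅, by simp, fun _ => Set.univ, by simp, by simp⟩
  have h1 := ext_on_measurableSpace_of_generate_finite mΩ C key hm
    (generateFrom_piiUnionInter_measurableSet (fun i => mS.comap (ξ i)) (Set.Ici (n + 1))).symm
    (isPiSystem_piiUnionInter _ (fun i => @MeasurableSpace.isPiSystem_measurableSet _
      (mS.comap (ξ i))) _) (key _ huniv) hA
  rwa [withDensity_apply _ (hm _ hA), Measure.restrict_apply (hm _ hA)] at h1

end IsStationaryReversibleMarkovChain

end Transition

/-! ### The transition operator on `L²(π)` and the forward-backward maximal inequality. -/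

section TransitionOperator

open scoped ENNReal InnerProductSpace

variable {Ω S : Type*} {mΩ : MeasurableSpace Ω} [mS : MeasurableSpace S] {P : Measure Ω}
  {Q : Kernel S S} {ξ : ℤ → Ω → S} {hξ : ∀ n, Measurable (ξ n)} {π : Measure S}

lemma integral_mul_eq_of_condExp_ae_eq [IsFiniteMeasure P] {m : MeasurableSpace Ω}
    (hm : m ≤ mΩ) {X Y Z : Ω → ℝ} (hX : MemLp X 2 P) (hZm : StronglyMeasurable[m] Z)
    (hZ : MemLp Z 2 P) (h : P[X | m] =ᵐ[P] Y) : ∫ ω, X ω * Z ω ∂P = ∫ ω, Y ω * Z ω ∂P := by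
  have h1 : P[X * Z | m] =ᵐ[P] P[X | m] * Z :=
    condExp_mul_of_stronglyMeasurable_right hZm (hX.integrable_mul hZ) (hX.integrable one_le_two)
  calc ∫ ω, X ω * Z ω ∂P = ∫ ω, (P[X * Z | m]) ω ∂P := (integral_condExp hm).symm
    _ = ∫ ω, Y ω * Z ω ∂P := by
        refine integral_congr_ae ?_
        filter_upwards [h1, h] with ω h1 h2
        simp [h1, h2]

/-- The isometry `g ↦ g ∘ X` of `L²` spaces given by a measure preserving map `X`. -/
noncomputable def compL2 {X : Ω → S} (hX : MeasurePreserving X P π) : Lp ℝ 2 π →ₗᵢ[ℝ] Lp ℝ 2 P :=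
  Lp.compMeasurePreservingₗᵢ ℝ X hX

lemma coeFn_compL2 {X : Ω → S} (hX : MeasurePreserving X P π) (g : Lp ℝ 2 π) :
    compL2 hX g =ᵐ[P] fun ω => g (X ω) :=
  Lp.coeFn_compMeasurePreserving g hX

lemma inner_eq_integral_mul (F G : Lp ℝ 2 P) : ⟪F, G⟫_ℝ = ∫ ω, F ω * G ω ∂P := by
  rw [L2.inner_def]
  refine integral_congr_ae (ae_of_all _ fun ω => ?_)
  simp [mul_comm]

lemma inner_compL2 {X Y : Ω → S} (hX : MeasurePreserving X P π) (hY : MeasurePreserving Y P π)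
    (g h : Lp ℝ 2 π) : ⟪compL2 hX g, compL2 hY h⟫_ℝ = ∫ ω, g (X ω) * h (Y ω) ∂P := by
  rw [inner_eq_integral_mul]
  refine integral_congr_ae ?_
  filter_upwards [coeFn_compL2 hX g, coeFn_compL2 hY h] with ω h1 h2
  rw [h1, h2]

lemma memLp_comp {X : Ω → S} (hX : MeasurePreserving X P π) (g : Lp ℝ 2 π) :
    MemLp (fun ω => g (X ω)) 2 P :=
  (Lp.memLp g).comp_measurePreserving hX

lemma norm_sq_eq_integral_comp {X : Ω → S} (hX : MeasurePreserving X P π) (g : Lp ℝ 2 π) :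
    ‖g‖ ^ 2 = ∫ ω, g (X ω) ^ 2 ∂P := by
  rw [← (compL2 hX).norm_map, ← real_inner_self_eq_norm_sq, inner_compL2]
  simp_rw [sq]

/-- `T` is the operator on `L²(π)` induced by one step of the chain, forward or backward. -/
structure IsTransitionOperator (P : Measure Ω) (ξ : ℤ → Ω → S) (hξ : ∀ n, Measurable (ξ n))
    (π : Measure S) (T : Lp ℝ 2 π →L[ℝ] Lp ℝ 2 π) : Prop where
  measurePreserving : ∀ n, MeasurePreserving (ξ n) P π
  norm_le : ∀ g, ‖T g‖ ≤ ‖g‖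
  symm : ∀ g h, ⟪T g, h⟫_ℝ = ⟪g, T h⟫_ℝ
  condExp_past : ∀ (n : ℤ) (g : Lp ℝ 2 π),
    P[fun ω => g (ξ (n + 1) ω) | pastFiltration ξ hξ n] =ᵐ[P] fun ω => T g (ξ n ω)
  condExp_future : ∀ (n : ℤ) (g : Lp ℝ 2 π),
    P[fun ω => g (ξ n ω) | futureSigma ξ (n + 1)] =ᵐ[P] fun ω => T g (ξ (n + 1) ω)

/-- Taking `T` as the adjoint of composition with `ξ 0` after composition with `ξ 1` makes it well
defined on classes and bounded from the start. The formula `∫ y, g y ∂Q x` is then recovered almost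
everywhere. -/
theorem IsStationaryReversibleMarkovChain.exists_isTransitionOperator [IsFiniteMeasure P]
    [IsMarkovKernel Q] (hc : IsStationaryReversibleMarkovChain P ξ hξ π Q) :
    ∃ T, IsTransitionOperator P ξ hξ π T := by
  have hmp := hc.measurePreserving
  set T : Lp ℝ 2 π →L[ℝ] Lp ℝ 2 π :=
    (compL2 (hmp 0)).toContinuousLinearMap.adjoint ∘L (compL2 (hmp 1)).toContinuousLinearMap
    with hT
  have hTinner : ∀ g h, ⟪T g, h⟫_ℝ = ∫ ω, g (ξ 1 ω) * h (ξ 0 ω) ∂P := fun g h => by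
    rw [← inner_compL2 (hmp 1) (hmp 0)]
    simp [hT, ContinuousLinearMap.adjoint_inner_left]
  have hpast : ∀ (n : ℤ) (g : Lp ℝ 2 π), P[fun ω => g (ξ (n + 1) ω) | pastFiltration ξ hξ n]
      =ᵐ[P] fun ω => ∫ y, g y ∂Q (ξ n ω) := fun n g =>
    (hc.isTransition_past n).condExp_ae_eq ((pastFiltration ξ hξ).le n) (hξ _)
      (measurable_pastFiltration hξ le_rfl) (Lp.stronglyMeasurable g)
      ((memLp_comp (hmp (n + 1)) g).integrable one_le_two)
  have hfuture : ∀ (n : ℤ) (g : Lp ℝ 2 π), P[fun ω => g (ξ n ω) | futureSigma ξ (n + 1)]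
      =ᵐ[P] fun ω => ∫ y, g y ∂Q (ξ (n + 1) ω) := fun n g =>
    (hc.isTransition_future n).condExp_ae_eq (futureSigma_le hξ _) (hξ _)
      (measurable_futureSigma ξ le_rfl) (Lp.stronglyMeasurable g)
      ((memLp_comp (hmp n) g).integrable one_le_two)
  have hmemLp : ∀ K : S → ℝ, StronglyMeasurable K → MemLp (fun ω => K (ξ 0 ω)) 2 P →
      MemLp K 2 π := fun K hK h => by
    rw [← (hmp 0).map_eq]
    exact (memLp_map_measure_iff hK.aestronglyMeasurable (hξ 0).aemeasurable).2 h
  have hTK : ∀ g : Lp ℝ 2 π, T g =ᵐ[π] fun x => ∫ y, g y ∂Q x := by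
    intro g
    have hKm : StronglyMeasurable fun x => ∫ y, g y ∂Q x :=
      (Lp.stronglyMeasurable g).integral_kernel
    have h1 : MemLp (fun ω => ∫ y, g y ∂Q (ξ 0 ω)) 2 P :=
      (memLp_congr_ae (hpast 0 g)).1 ((memLp_comp (hmp (0 + 1)) g).condExp one_le_two)
    have hK : MemLp (fun x => ∫ y, g y ∂Q x) 2 π := hmemLp _ hKm h1
    have h2 : T g = hK.toLp := by
      refine ext_inner_right ℝ fun h => ?_
      rw [hTinner, integral_mul_eq_of_condExp_ae_eq ((pastFiltration ξ hξ).le 0)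
        (Z := fun ω => h (ξ 0 ω)) (memLp_comp (hmp 1) g) ((Lp.stronglyMeasurable h).comp_measurable
        (measurable_pastFiltration hξ le_rfl)) (memLp_comp (hmp 0) h) (hpast 0 g),
        ← (compL2 (hmp 0)).inner_map_map, inner_compL2]
      refine integral_congr_ae ?_
      filter_upwards [(hmp 0).quasiMeasurePreserving.ae_eq_comp hK.coeFn_toLp] with ω h3
      simp only [Function.comp_apply] at h3
      simp only [h3]
    rw [h2]
    exact hK.coeFn_toLp
  have hTKξ : ∀ (n : ℤ) (g : Lp ℝ 2 π), (fun ω => ∫ y, g y ∂Q (ξ n ω)) =ᵐ[P]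
      fun ω => T g (ξ n ω) := fun n g =>
    ((hmp n).quasiMeasurePreserving.ae_eq_comp (hTK g)).symm
  refine ⟨T, hmp, fun g => ?_, fun g h => ?_, fun n g => (hpast n g).trans (hTKξ n g),
    fun n g => (hfuture n g).trans (hTKξ _ g)⟩
  · have h1 : ‖T g‖ ^ 2 ≤ ‖T g‖ * ‖g‖ := by
      have h2 : ⟪T g, T g⟫_ℝ = ⟪compL2 (hmp 1) g, compL2 (hmp 0) (T g)⟫_ℝ := by
        rw [hTinner, inner_compL2]
      rw [← real_inner_self_eq_norm_sq, h2]
      refine (real_inner_le_norm _ _).trans_eq ?_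
      rw [LinearIsometry.norm_map, LinearIsometry.norm_map, mul_comm]
    rcases (norm_nonneg (T g)).eq_or_lt with h | h
    · rw [← h]; positivity
    · nlinarith
  -- Symmetry comes from conditioning E[g(ξ_1) h(ξ_0)] on the future instead of the past.
  · have h1 := integral_mul_eq_of_condExp_ae_eq (futureSigma_le hξ _) (memLp_comp (hmp 0) h)
      ((Lp.stronglyMeasurable g).comp_measurable (measurable_futureSigma ξ le_rfl))
      (memLp_comp (hmp (0 + 1)) g) ((hfuture 0 h).trans (hTKξ _ h))
    rw [hTinner, ← (compL2 (hmp 1)).inner_map_map, inner_compL2]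
    simp only [zero_add, Function.comp_apply] at h1
    simp_rw [mul_comm (g _), h1]

/-- The reversed filtration `k ↦ σ(ξ i : i ≥ n - k)`. -/
def futureFiltration (ξ : ℤ → Ω → S) (hξ : ∀ n, Measurable (ξ n)) (n : ℤ) : Filtration ℕ mΩ where
  seq k := futureSigma ξ (n - k)
  mono' i j hij := futureSigma_anti ξ (by have : (i : ℤ) ≤ j := by exact_mod_cast hij
                                          omega)
  le' _ := futureSigma_le hξ _

namespace IsTransitionOperator

variable {T : Lp ℝ 2 π →L[ℝ] Lp ℝ 2 π}

lemma integral_mul_comp_of_le [IsFiniteMeasure P] (hT : IsTransitionOperator P ξ hξ π T)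
    {i j : ℤ} (hij : j ≤ i) (g h : Lp ℝ 2 π) :
    ∫ ω, g (ξ (i + 1) ω) * h (ξ j ω) ∂P = ∫ ω, T g (ξ i ω) * h (ξ j ω) ∂P :=
  integral_mul_eq_of_condExp_ae_eq ((pastFiltration ξ hξ).le i)
    (memLp_comp (hT.measurePreserving _) g) ((Lp.stronglyMeasurable h).comp_measurable
    (measurable_pastFiltration hξ hij)) (memLp_comp (hT.measurePreserving _) h)
    (hT.condExp_past i g)

lemma condExp_sub_past [IsFiniteMeasure P] (hT : IsTransitionOperator P ξ hξ π T) (n : ℤ)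
    (g : Lp ℝ 2 π) :
    P[fun ω => g (ξ (n + 1) ω) - T g (ξ n ω) | pastFiltration ξ hξ n] =ᵐ[P] 0 := by
  have i1 := (memLp_comp (hT.measurePreserving (n + 1)) g).integrable one_le_two
  have i2 := (memLp_comp (hT.measurePreserving n) (T g)).integrable one_le_two
  have h1 := condExp_sub i1 i2 (pastFiltration ξ hξ n)
  have h2 := condExp_of_stronglyMeasurable ((pastFiltration ξ hξ).le n)
    ((Lp.stronglyMeasurable (T g)).comp_measurable (measurable_pastFiltration hξ le_rfl)) i2
  filter_upwards [h1, hT.condExp_past n g] with ω h3 h4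
  change (P[(fun ω => g (ξ (n + 1) ω)) - (fun ω => T g (ξ n ω)) | pastFiltration ξ hξ n]) ω = 0
  rw [h3, Pi.sub_apply, h4]
  exact sub_eq_zero.2 (congrFun h2 ω).symm

lemma condExp_sub_future [IsFiniteMeasure P] (hT : IsTransitionOperator P ξ hξ π T) (n : ℤ)
    (g : Lp ℝ 2 π) :
    P[fun ω => g (ξ n ω) - T g (ξ (n + 1) ω) | futureSigma ξ (n + 1)] =ᵐ[P] 0 := by
  have i1 := (memLp_comp (hT.measurePreserving n) g).integrable one_le_two
  have i2 := (memLp_comp (hT.measurePreserving (n + 1)) (T g)).integrable one_le_two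
  have h1 := condExp_sub i1 i2 (futureSigma ξ (n + 1))
  have h2 := condExp_of_stronglyMeasurable (futureSigma_le hξ (n + 1))
    ((Lp.stronglyMeasurable (T g)).comp_measurable (measurable_futureSigma ξ le_rfl)) i2
  filter_upwards [h1, hT.condExp_future n g] with ω h3 h4
  change (P[(fun ω => g (ξ n ω)) - (fun ω => T g (ξ (n + 1) ω)) | futureSigma ξ (n + 1)]) ω = 0
  rw [h3, Pi.sub_apply, h4]
  exact sub_eq_zero.2 (congrFun h2 ω).symm

/-- Pythagoras; `i` and `j` are left free so that it serves both directions of time. -/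
lemma integral_sub_sq_eq (hT : IsTransitionOperator P ξ hξ π T) {i j : ℤ} {g : Lp ℝ 2 π}
    (h : ∫ ω, g (ξ i ω) * T g (ξ j ω) ∂P = ∫ ω, T g (ξ j ω) * T g (ξ j ω) ∂P) :
    ∫ ω, (g (ξ i ω) - T g (ξ j ω)) ^ 2 ∂P = ‖g‖ ^ 2 - ‖T g‖ ^ 2 := by
  have m1 := memLp_comp (hT.measurePreserving i) g
  have m2 := memLp_comp (hT.measurePreserving j) (T g)
  have i1 := m1.integrable_sq
  have i2 := (m1.integrable_mul m2).const_mul 2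
  have i3 := m2.integrable_sq
  have h1 := norm_sq_eq_integral_comp (hT.measurePreserving i) g
  have h2 := norm_sq_eq_integral_comp (hT.measurePreserving j) (T g)
  simp_rw [← sq] at h
  rw [← h2] at h
  have e : ∀ ω, (g (ξ i ω) - T g (ξ j ω)) ^ 2
      = g (ξ i ω) ^ 2 - 2 * (g (ξ i ω) * T g (ξ j ω)) + T g (ξ j ω) ^ 2 := fun ω => by ring
  simp only [Pi.mul_apply] at i2
  simp_rw [e]
  rw [integral_add (f := fun ω => g (ξ i ω) ^ 2 - 2 * (g (ξ i ω) * T g (ξ j ω))) (i1.sub i2) i3,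
    integral_sub i1 i2, integral_const_mul, h, ← h1, ← h2]
  ring

lemma integral_past_sq [IsFiniteMeasure P] (hT : IsTransitionOperator P ξ hξ π T) (n : ℤ)
    (g : Lp ℝ 2 π) :
    ∫ ω, (g (ξ (n + 1) ω) - T g (ξ n ω)) ^ 2 ∂P = ‖g‖ ^ 2 - ‖T g‖ ^ 2 :=
  hT.integral_sub_sq_eq (hT.integral_mul_comp_of_le le_rfl g (T g))

lemma integral_future_sq [IsFiniteMeasure P] (hT : IsTransitionOperator P ξ hξ π T) (n : ℤ)
    (g : Lp ℝ 2 π) :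
    ∫ ω, (g (ξ n ω) - T g (ξ (n + 1) ω)) ^ 2 ∂P = ‖g‖ ^ 2 - ‖T g‖ ^ 2 :=
  hT.integral_sub_sq_eq (integral_mul_eq_of_condExp_ae_eq (futureSigma_le hξ (n + 1))
    (memLp_comp (hT.measurePreserving _) g) ((Lp.stronglyMeasurable (T g)).comp_measurable
    (measurable_futureSigma ξ le_rfl)) (memLp_comp (hT.measurePreserving _) (T g))
    (hT.condExp_future n g))

end IsTransitionOperator

lemma maxSq_mono {Y Z : ℕ → Ω → ℝ} {n : ℕ} (h : ∀ᵐ ω ∂P, ∀ j ≤ n, |Y j ω| ≤ |Z j ω|) :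
    maxSq P Y n ≤ maxSq P Z n := by
  refine maxSq_le_of_ae_le ?_
  filter_upwards [h] with ω hω j hj
  refine le_trans ?_ (enorm_sq_le_iSup hj ω)
  gcongr
  rw [Real.enorm_eq_ofReal_abs, Real.enorm_eq_ofReal_abs]
  exact ENNReal.ofReal_le_ofReal (hω j hj)

lemma maxSq_add_le_ofReal {Y Z W : ℕ → Ω → ℝ} (hY : ∀ j, AEMeasurable (Y j) P) {n : ℕ} {a b : ℝ}
    (hYa : maxSq P Y n ≤ ENNReal.ofReal a) (hZb : maxSq P Z n ≤ ENNReal.ofReal b) (ha : 0 ≤ a)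
    (hb : 0 ≤ b) (h : ∀ᵐ ω ∂P, ∀ j ≤ n, W j ω = Y j ω + Z j ω) :
    maxSq P W n ≤ ENNReal.ofReal (2 * a + 2 * b) := by
  refine (maxSq_add_le hY h).trans ?_
  rw [ENNReal.ofReal_add (by positivity) (by positivity), ENNReal.ofReal_mul (by norm_num),
    ENNReal.ofReal_mul (by norm_num), ENNReal.ofReal_ofNat]
  gcongr

/-- The maximum of the differences of two terms of a sequence. -/
lemma maxSq_sub_le_ofReal {Y W : ℕ → Ω → ℝ} {n : ℕ} {a : ℝ}
    (hYa : maxSq P Y n ≤ ENNReal.ofReal a)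
    (h : ∀ᵐ ω ∂P, ∀ j ≤ n, ∃ k ≤ n, ∃ l ≤ n, W j ω = Y k ω - Y l ω) :
    maxSq P W n ≤ ENNReal.ofReal (4 * a) := by
  rw [ENNReal.ofReal_mul (by norm_num), ENNReal.ofReal_ofNat]
  refine le_trans ?_ (mul_le_mul_right hYa 4)
  unfold maxSq
  rw [← lintegral_const_mul' _ _ (by norm_num)]
  refine maxSq_le_of_ae_le ?_
  filter_upwards [h] with ω hω j hj
  obtain ⟨k, hk, l, hl, e⟩ := hω j hj
  rw [e, sub_eq_add_neg]
  refine (enorm_add_sq_le _ _).trans ?_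
  rw [enorm_neg, show (4 : ℝ≥0∞) = 2 + 2 by norm_num, add_mul]
  gcongr
  · exact enorm_sq_le_iSup hk ω
  · exact enorm_sq_le_iSup hl ω

/-- The maximal inequality for additive functionals of a reversible chain, by the forward-backward
martingale decomposition. -/
theorem IsTransitionOperator.maxSq_sum_sub_le [IsFiniteMeasure P]
    {T : Lp ℝ 2 π →L[ℝ] Lp ℝ 2 π} (hT : IsTransitionOperator P ξ hξ π T) (g : Lp ℝ 2 π) (n : ℕ) :
    maxSq P (fun j ω => ∑ i ∈ Finset.range j, (g - T g : Lp ℝ 2 π) (ξ (i : ℤ) ω)) n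
      ≤ ENNReal.ofReal (176 * ((n + 1) * dirichletForm T g)) := by
  set h : Lp ℝ 2 π := g - T g with hh
  set E := dirichletForm T g with hE
  have hmp := hT.measurePreserving
  have hE0 : 0 ≤ E := dirichletForm_nonneg hT.norm_le g
  have hle := norm_sq_sub_norm_sq_le_dirichletForm T g
  have hhle := norm_sub_sq_le_dirichletForm hT.norm_le g
  have hsm : ∀ {m : MeasurableSpace Ω} {i : ℤ} (u : Lp ℝ 2 π), Measurable[m] (ξ i) →
      StronglyMeasurable[m] fun ω => u (ξ i ω) := fun u hu =>
    (Lp.stronglyMeasurable u).comp_measurable hu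
  have hforward : maxSq P (fun j ω => ∑ i ∈ Finset.range j,
      (g (ξ ((i : ℤ) + 1) ω) - T g (ξ (i : ℤ) ω))) n ≤ ENNReal.ofReal (8 * ((n + 1) * E)) := by
    refine (maxSq_sum_le (pastFiltrationNat ξ hξ)
      (d := fun (i : ℕ) ω => g (ξ ((i : ℤ) + 1) ω) - T g (ξ (i : ℤ) ω)) (c := 2 * E)
      (fun k _ => (memLp_comp (hmp _) g).sub (memLp_comp (hmp _) (T g)))
      (fun k _ => ?_) (fun k _ => hT.condExp_sub_past k g)
      (fun k _ => (hT.integral_past_sq k g).trans_le hle)).trans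
      (ENNReal.ofReal_le_ofReal (by nlinarith))
    have h1 : pastFiltrationNat ξ hξ (k + 1) = pastFiltration ξ hξ ((k : ℤ) + 1) := rfl
    rw [h1]
    exact (hsm g (measurable_pastFiltration hξ le_rfl)).sub
      (hsm (T g) (measurable_pastFiltration hξ (by omega)))
  have hbackward : maxSq P (fun j ω => ∑ i ∈ Finset.range j,
      (g (ξ ((n : ℤ) - (i + 1)) ω) - T g (ξ ((n : ℤ) - i) ω))) n
      ≤ ENNReal.ofReal (8 * ((n + 1) * E)) := by
    refine (maxSq_sum_le (futureFiltration ξ hξ n)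
      (d := fun (i : ℕ) ω => g (ξ ((n : ℤ) - (i + 1)) ω) - T g (ξ ((n : ℤ) - i) ω)) (c := 2 * E)
      (fun k _ => (memLp_comp (hmp _) g).sub (memLp_comp (hmp _) (T g)))
      (fun k _ => ?_) (fun k _ => ?_) (fun k _ => ?_)).trans
      (ENNReal.ofReal_le_ofReal (by nlinarith))
    · have h1 : futureFiltration ξ hξ n (k + 1) = futureSigma ξ ((n : ℤ) - ((k + 1 : ℕ) : ℤ)) := rfl
      rw [h1]
      exact (hsm g (measurable_futureSigma ξ (by push_cast; omega))).sub
        (hsm (T g) (measurable_futureSigma ξ (by push_cast; omega)))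
    · have h1 := hT.condExp_sub_future ((n : ℤ) - (k + 1)) g
      rw [show (n : ℤ) - (k + 1) + 1 = n - k by ring] at h1
      exact h1
    · have h1 := hT.integral_future_sq ((n : ℤ) - (k + 1)) g
      rw [show (n : ℤ) - (k + 1) + 1 = n - k by ring] at h1
      exact h1.trans_le hle
  have hbackward' : maxSq P (fun j ω => ∑ i ∈ Finset.range j,
      (g (ξ (i : ℤ) ω) - T g (ξ ((i : ℤ) + 1) ω))) n
      ≤ ENNReal.ofReal (4 * (8 * ((n + 1) * E))) := by
    -- The backward martingale starts at time `n`, so the sum over `i < j` is its value after `n`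
    -- steps minus its value after `n - j` steps.
    refine maxSq_sub_le_ofReal hbackward (ae_of_all _ fun ω j hj => ⟨n, le_rfl, n - j, by omega, ?_⟩)
    obtain ⟨k, rfl⟩ := Nat.exists_eq_add_of_le' hj
    rw [Nat.add_sub_cancel, Finset.sum_range_add _ k j, add_sub_cancel_left,
      ← Finset.sum_range_reflect]
    refine Finset.sum_congr rfl fun i hi => ?_
    have hi' := Finset.mem_range.1 hi
    congr 3 <;> omega
  have hend : maxSq P (fun j ω => h (ξ 0 ω) - h (ξ (j : ℤ) ω)) n
      ≤ ENNReal.ofReal (4 * (2 * ((n + 1) * E))) := by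
    refine maxSq_sub_le_ofReal (Y := fun j ω => h (ξ (j : ℤ) ω)) ?_
      (ae_of_all _ fun ω j hj => ⟨0, by omega, j, hj, rfl⟩)
    refine (maxSq_le_sum (fun j => (hsm h (hξ j)).measurable.aemeasurable) n).trans ?_
    have h1 : ∀ j ∈ Finset.range (n + 1), ∫⁻ ω, ‖h (ξ (j : ℤ) ω)‖ₑ ^ 2 ∂P
        ≤ ENNReal.ofReal (2 * E) := fun j _ => by
      rw [lintegral_enorm_sq_eq_ofReal (memLp_comp (hmp _) h), ← norm_sq_eq_integral_comp (hmp _)]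
      exact ENNReal.ofReal_le_ofReal hhle
    refine (Finset.sum_le_card_nsmul _ _ _ h1).trans_eq ?_
    rw [Finset.card_range, ← ENNReal.ofReal_nsmul, nsmul_eq_mul]
    congr 1
    push_cast
    ring
  have hmeas : ∀ (i : ℤ) (u : Lp ℝ 2 π), Measurable fun ω => u (ξ i ω) := fun i u =>
    (hsm u (hξ i)).measurable
  have hsum := maxSq_add_le_ofReal (W := fun j ω => ∑ i ∈ Finset.range j,
      ((g (ξ ((i : ℤ) + 1) ω) - T g (ξ (i : ℤ) ω)) + (g (ξ (i : ℤ) ω) - T g (ξ ((i : ℤ) + 1) ω))))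
    (fun j => (Finset.measurable_fun_sum _ fun i _ =>
      (hmeas _ g).sub (hmeas _ (T g))).aemeasurable) hforward hbackward' (by positivity)
      (by positivity) (ae_of_all _ fun ω j _ => Finset.sum_add_distrib)
  -- The forward and backward increments at `i` add up to `h (ξ i) + h (ξ (i + 1))`; shifting the
  -- index costs `h (ξ 0) - h (ξ j)`. The constants are 8 and 32 for the martingales and 8 for the
  -- boundary: 2 (2·8 + 2·32) + 2·8 = 176. The factor 2 in `W` is given away.
  have hsum2 := maxSq_add_le_ofReal (Y := fun j ω => ∑ i ∈ Finset.range j,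
      ((g (ξ ((i : ℤ) + 1) ω) - T g (ξ (i : ℤ) ω)) + (g (ξ (i : ℤ) ω) - T g (ξ ((i : ℤ) + 1) ω))))
    (Z := fun j ω => h (ξ 0 ω) - h (ξ (j : ℤ) ω)) (W := fun j ω => 2 * ∑ i ∈ Finset.range j, h (ξ (i : ℤ) ω))
    (fun j => (Finset.measurable_fun_sum _ fun i _ => ((hmeas _ g).sub (hmeas _ (T g))).add
      ((hmeas _ g).sub (hmeas _ (T g)))).aemeasurable) hsum hend (by positivity)
      (by positivity) ?_
  · refine (maxSq_mono (ae_of_all _ fun ω j _ => ?_)).trans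
      (hsum2.trans (ENNReal.ofReal_le_ofReal (by linarith)))
    rw [abs_mul, abs_two]
    linarith [abs_nonneg (∑ i ∈ Finset.range j, h (ξ (i : ℤ) ω))]
  · have hae : ∀ i : ℤ, ∀ᵐ ω ∂P, h (ξ i ω) = g (ξ i ω) - T g (ξ i ω) := fun i =>
      (hmp i).quasiMeasurePreserving.ae_eq_comp (Lp.coeFn_sub g (T g))
    filter_upwards [ae_all_iff.2 hae] with ω hω j hj
    clear hj
    induction j with
    | zero => simp
    | succ j ih =>
      rw [Finset.sum_range_succ, mul_add, ih, Finset.sum_range_succ _ j]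
      simp only [hω]
      push_cast
      ring

end TransitionOperator

/-! ### Passage to the limit and the limiting martingale. -/

section Approximation

open scoped ENNReal InnerProductSpace NNReal

variable {Ω S : Type*} {mΩ : MeasurableSpace Ω} [mS : MeasurableSpace S] {P : Measure Ω}
  {Q : Kernel S S} {ξ : ℤ → Ω → S} {hξ : ∀ n, Measurable (ξ n)} {π : Measure S}

/-- The maximum of `n + 1` identically distributed squares is `o(n)` in the mean. -/
lemma exists_maxSq_comp_le [IsProbabilityMeasure P] (hmp : ∀ n, MeasurePreserving (ξ n) P π)
    (g : Lp ℝ 2 π) {ε : ℝ} (hε : 0 < ε) : ∃ C, 0 ≤ C ∧ ∀ n : ℕ,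
      maxSq P (fun j ω => g (ξ (j : ℤ) ω)) n ≤ ENNReal.ofReal (C + ε * (n + 1)) := by
  -- Truncation at `M`: the bounded part contributes `M²` whatever `n` is, and the maximum over the
  -- tail part is bounded by a sum of terms of mean at most `ε`.
  obtain ⟨M, hM⟩ := (Lp.memLp g).eLpNorm_indicator_norm_ge_le (Lp.stronglyMeasurable g)
    (Real.sqrt_pos.2 hε)
  set b : S → ℝ := {x | M ≤ ‖g x‖₊}.indicator g with hb
  have hbm : StronglyMeasurable b := (Lp.stronglyMeasurable g).indicator
    (measurableSet_le measurable_const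
      (Lp.stronglyMeasurable g).measurable.nnnorm.coe_nnreal_real)
  have hbint : ∫⁻ x, ‖b x‖ₑ ^ 2 ∂π ≤ ENNReal.ofReal ε := by
    have h1 := eLpNorm_nnreal_pow_eq_lintegral (f := b) (μ := π) (p := 2) (by norm_num)
    norm_num at h1
    rw [← h1, ← Real.sq_sqrt hε.le, ENNReal.ofReal_pow (Real.sqrt_nonneg _)]
    gcongr
  have hbξ : ∀ i : ℕ, Measurable fun ω => ‖b (ξ (i : ℤ) ω)‖ₑ ^ 2 := fun i =>
    (hbm.measurable.comp (hmp i).measurable).enorm.pow_const 2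
  refine ⟨M ^ 2, by positivity, fun n => ?_⟩
  have hpt : ∀ x, ‖g x‖ₑ ^ 2 ≤ ENNReal.ofReal (M ^ 2) + ‖b x‖ₑ ^ 2 := by
    intro x
    by_cases hx : x ∈ {x | M ≤ ‖g x‖₊}
    · rw [hb, Set.indicator_of_mem hx]
      exact le_add_self
    · refine le_add_right ?_
      rw [← ofReal_norm, ← ENNReal.ofReal_pow (norm_nonneg _)]
      refine ENNReal.ofReal_le_ofReal ?_
      have : ‖g x‖ ≤ M := by simpa using (not_le.1 hx).le
      gcongr
  calc maxSq P (fun j ω => g (ξ (j : ℤ) ω)) n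
      ≤ ∫⁻ ω, (ENNReal.ofReal (M ^ 2)
        + ∑ i ∈ Finset.range (n + 1), ‖b (ξ (i : ℤ) ω)‖ₑ ^ 2) ∂P := by
        refine maxSq_le_of_ae_le (ae_of_all _ fun ω j hj => (hpt _).trans ?_)
        gcongr
        exact Finset.single_le_sum (f := fun i : ℕ => ‖b (ξ (i : ℤ) ω)‖ₑ ^ 2)
          (fun _ _ => zero_le) (Finset.mem_range.2 (Nat.lt_succ_iff.2 hj))
    _ = ENNReal.ofReal (M ^ 2) + ∑ i ∈ Finset.range (n + 1), ∫⁻ x, ‖b x‖ₑ ^ 2 ∂π := by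
        rw [lintegral_add_left measurable_const, lintegral_const, measure_univ, mul_one,
          lintegral_finsetSum _ fun i _ => hbξ i]
        congr 1
        refine Finset.sum_congr rfl fun i _ => ?_
        exact (hmp i).lintegral_comp (hbm.measurable.enorm.pow_const 2)
    _ ≤ ENNReal.ofReal (M ^ 2) + ENNReal.ofReal (ε * (n + 1)) := by
        gcongr
        refine (Finset.sum_le_card_nsmul _ _ _ fun _ _ => hbint).trans_eq ?_
        rw [Finset.card_range, ← ENNReal.ofReal_nsmul, nsmul_eq_mul]
        congr 1
        push_cast
        ring
    _ = _ := (ENNReal.ofReal_add (by positivity) (by positivity)).symm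

lemma lintegral_enorm_Lp_sq (F : Lp ℝ 2 P) : ∫⁻ ω, ‖F ω‖ₑ ^ 2 ∂P = ENNReal.ofReal (‖F‖ ^ 2) := by
  rw [lintegral_enorm_sq_eq_ofReal (Lp.memLp F), ← real_inner_self_eq_norm_sq,
    inner_eq_integral_mul]
  simp_rw [sq]

lemma sum_compL2_ae_eq (hmp : ∀ n, MeasurePreserving (ξ n) P π) (u : Lp ℝ 2 π) (n : ℕ) :
    (fun ω => ∑ i ∈ Finset.range n, u (ξ (i : ℤ) ω))
      =ᵐ[P] ((∑ i ∈ Finset.range n, compL2 (hmp i) u : Lp ℝ 2 P) : Ω → ℝ) := by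
  induction n with
  | zero =>
    filter_upwards [Lp.coeFn_zero ℝ 2 P] with ω h
    simp only [Finset.range_zero, Finset.sum_empty]
    exact h.symm
  | succ n ih =>
    rw [Finset.sum_range_succ]
    filter_upwards [ih, Lp.coeFn_add (∑ i ∈ Finset.range n, compL2 (hmp i) u) (compL2 (hmp n) u),
      coeFn_compL2 (hmp n) u] with ω h1 h2 h3
    rw [h2, Pi.add_apply, ← h1, h3, Finset.sum_range_succ]

lemma measurable_sum_comp (hmp : ∀ n, MeasurePreserving (ξ n) P π) (u : Lp ℝ 2 π) (j : ℕ) :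
    Measurable fun ω => ∑ i ∈ Finset.range j, u (ξ (i : ℤ) ω) :=
  Finset.measurable_fun_sum _ fun i _ =>
    (Lp.stronglyMeasurable u).measurable.comp (hmp i).measurable

/-- A crude bound for the maximum of the partial sums. -/
lemma maxSq_sum_comp_le (hmp : ∀ n, MeasurePreserving (ξ n) P π) (u : Lp ℝ 2 π) (n : ℕ) :
    maxSq P (fun j ω => ∑ i ∈ Finset.range j, u (ξ (i : ℤ) ω)) n
      ≤ ENNReal.ofReal ((n + 1) ^ 3 * ‖u‖ ^ 2) := by
  refine (maxSq_le_sum (fun j => (measurable_sum_comp hmp u j).aemeasurable) n).trans ?_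
  have h1 : ∀ j ∈ Finset.range (n + 1), ∫⁻ ω, ‖∑ i ∈ Finset.range j, u (ξ (i : ℤ) ω)‖ₑ ^ 2 ∂P
      ≤ ENNReal.ofReal ((n + 1) ^ 2 * ‖u‖ ^ 2) := by
    intro j hj
    have h2 : ‖∑ i ∈ Finset.range j, compL2 (hmp i) u‖ ≤ (n + 1) * ‖u‖ := by
      refine (norm_sum_le _ _).trans ?_
      simp only [LinearIsometry.norm_map, Finset.sum_const, Finset.card_range, nsmul_eq_mul]
      gcongr
      exact_mod_cast (Finset.mem_range.1 hj).le
    have h3 := lintegral_congr_ae ((sum_compL2_ae_eq hmp u j).fun_comp fun x => ‖x‖ₑ ^ 2)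
    simp only [Function.comp_apply] at h3
    rw [h3, lintegral_enorm_Lp_sq, ← mul_pow]
    refine ENNReal.ofReal_le_ofReal ?_
    gcongr
  refine (Finset.sum_le_card_nsmul _ _ _ h1).trans_eq ?_
  rw [Finset.card_range, ← ENNReal.ofReal_nsmul, nsmul_eq_mul]
  congr 1
  push_cast
  ring

/-- If `f` is a limit of `g k - T (g k)` with `g` Cauchy for the Dirichlet form, then the partial
sums of `f - (g k - T (g k))` satisfy a uniform maximal inequality. -/
lemma IsTransitionOperator.maxSq_sum_sub_le_of_tendsto [IsFiniteMeasure P]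
    {T : Lp ℝ 2 π →L[ℝ] Lp ℝ 2 π} (hT : IsTransitionOperator P ξ hξ π T) {f : Lp ℝ 2 π}
    {g : ℕ → Lp ℝ 2 π} (hg : Tendsto (fun k => g k - T (g k)) atTop (𝓝 f)) {k N : ℕ} {ε : ℝ}
    (hE : ∀ l ≥ N, dirichletForm T (g k - g l) ≤ ε) (n : ℕ) :
    maxSq P (fun j ω => ∑ i ∈ Finset.range j,
      (f - (g k - T (g k)) : Lp ℝ 2 π) (ξ (i : ℤ) ω)) n
      ≤ ENNReal.ofReal (352 * ((n + 1) * ε)) := by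
  have hmp := hT.measurePreserving
  have hε : 0 ≤ ε := (dirichletForm_nonneg hT.norm_le _).trans (hE N le_rfl)
  -- Here `n` is fixed and `l → ∞`, so the cubic factor of the crude bound is harmless. The
  -- difference `g l - g k` is handled by the maximal inequality, uniformly in `l`; 352 = 2·176.
  have hlim : Tendsto (fun l => ENNReal.ofReal (2 * ((n + 1) ^ 3 * ‖f - (g l - T (g l))‖ ^ 2)
      + 2 * (176 * ((n + 1) * ε)))) atTop (𝓝 (ENNReal.ofReal (2 * ((n + 1) ^ 3 * 0 ^ 2)
      + 2 * (176 * ((n + 1) * ε))))) := by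
    have h1 : Tendsto (fun l => ‖f - (g l - T (g l))‖) atTop (𝓝 0) := by
      simpa [norm_sub_rev] using tendsto_iff_norm_sub_tendsto_zero.1 hg
    exact ENNReal.tendsto_ofReal ((((h1.pow 2).const_mul _).const_mul _).add_const _)
  have hlim' := ge_of_tendsto hlim (b := maxSq P (fun j ω => ∑ i ∈ Finset.range j,
      (f - (g k - T (g k)) : Lp ℝ 2 π) (ξ (i : ℤ) ω)) n) ?_
  · refine hlim'.trans (ENNReal.ofReal_le_ofReal (by linarith))
  filter_upwards [eventually_ge_atTop N] with l hl
  have h1 := maxSq_sum_comp_le hmp (f - (g l - T (g l))) n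
  have h2 := (hT.maxSq_sum_sub_le (g l - g k) n).trans
    (ENNReal.ofReal_le_ofReal (q := 176 * ((n + 1) * ε)) (by
      have h3 : dirichletForm T (g l - g k) = dirichletForm T (g k - g l) := by
        rw [← neg_sub (g k), dirichletForm, map_neg, ← neg_sub', inner_neg_neg, dirichletForm]
      rw [h3]
      gcongr
      exact hE l hl))
  refine maxSq_add_le_ofReal (fun j => (measurable_sum_comp hmp _ j).aemeasurable) h1 h2
    (by positivity) (by positivity) ?_
  have hae : ∀ i : ℤ, ∀ᵐ ω ∂P, (f - (g k - T (g k)) : Lp ℝ 2 π) (ξ i ω)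
      = (f - (g l - T (g l)) : Lp ℝ 2 π) (ξ i ω)
        + (g l - g k - T (g l - g k) : Lp ℝ 2 π) (ξ i ω) := fun i => by
    have h4 : f - (g k - T (g k)) = (f - (g l - T (g l))) + (g l - g k - T (g l - g k)) := by
      rw [map_sub]; abel
    have h5 := Lp.coeFn_add (f - (g l - T (g l))) (g l - g k - T (g l - g k))
    rw [← h4] at h5
    exact (hmp i).quasiMeasurePreserving.ae_eq_comp h5
  filter_upwards [ae_all_iff.2 hae] with ω hω j _
  rw [← Finset.sum_add_distrib]
  exact Finset.sum_congr rfl fun i _ => hω i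

/-- The law of two consecutive states. -/
noncomputable def pairLaw (P : Measure Ω) (ξ : ℤ → Ω → S) : Measure (S × S) :=
  P.map fun ω => (ξ 0 ω, ξ 1 ω)

lemma IsStationaryReversibleMarkovChain.measurePreserving_pair
    (hc : IsStationaryReversibleMarkovChain P ξ hξ π Q) (n : ℤ) :
    MeasurePreserving (fun ω => (ξ n ω, ξ (n + 1) ω)) P (pairLaw P ξ) := by
  refine ⟨(hξ n).prodMk (hξ (n + 1)), ?_⟩
  have h1 := ((hc.stationary n).comp ((measurable_pi_apply (0 : ℤ)).prodMk
    (measurable_pi_apply (1 : ℤ)))).map_eq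
  simpa [Function.comp_def, add_comm, pairLaw] using h1

lemma IsStationaryReversibleMarkovChain.measurePreserving_fst
    (hc : IsStationaryReversibleMarkovChain P ξ hξ π Q) :
    MeasurePreserving Prod.fst (pairLaw P ξ) π :=
  ⟨measurable_fst, by
    rw [pairLaw, Measure.map_map measurable_fst ((hξ 0).prodMk (hξ 1))]
    exact (hc.measurePreserving 0).map_eq⟩

lemma IsStationaryReversibleMarkovChain.measurePreserving_snd
    (hc : IsStationaryReversibleMarkovChain P ξ hξ π Q) :
    MeasurePreserving Prod.snd (pairLaw P ξ) π :=
  ⟨measurable_snd, by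
    rw [pairLaw, Measure.map_map measurable_snd ((hξ 0).prodMk (hξ 1))]
    exact (hc.measurePreserving 1).map_eq⟩

/-- The martingale difference operator `g ↦ g(y) - T g(x)` into `L²` of the law of
two consecutive states. -/
noncomputable def martingaleDiff (hc : IsStationaryReversibleMarkovChain P ξ hξ π Q)
    (T : Lp ℝ 2 π →L[ℝ] Lp ℝ 2 π) : Lp ℝ 2 π →L[ℝ] Lp ℝ 2 (pairLaw P ξ) :=
  (compL2 hc.measurePreserving_snd).toContinuousLinearMap
    - (compL2 hc.measurePreserving_fst).toContinuousLinearMap ∘L T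

lemma martingaleDiff_ae_eq (hc : IsStationaryReversibleMarkovChain P ξ hξ π Q)
    (T : Lp ℝ 2 π →L[ℝ] Lp ℝ 2 π) (g : Lp ℝ 2 π) (n : ℤ) :
    (fun ω => martingaleDiff hc T g (ξ n ω, ξ (n + 1) ω))
      =ᵐ[P] fun ω => g (ξ (n + 1) ω) - T g (ξ n ω) := by
  have h1 : martingaleDiff hc T g =ᵐ[pairLaw P ξ] fun z => g z.2 - T g z.1 := by
    filter_upwards [Lp.coeFn_sub (compL2 hc.measurePreserving_snd g)
      (compL2 hc.measurePreserving_fst (T g)), coeFn_compL2 hc.measurePreserving_snd g,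
      coeFn_compL2 hc.measurePreserving_fst (T g)] with z h1 h2 h3
    rw [← h2, ← h3]
    exact h1
  exact (hc.measurePreserving_pair n).quasiMeasurePreserving.ae_eq_comp h1

/-- This turns Cauchy sequences for the Dirichlet form into Cauchy sequences of martingale
differences in `L²`. -/
lemma norm_martingaleDiff_sq_le [IsFiniteMeasure P]
    (hc : IsStationaryReversibleMarkovChain P ξ hξ π Q)
    {T : Lp ℝ 2 π →L[ℝ] Lp ℝ 2 π} (hT : IsTransitionOperator P ξ hξ π T) (g : Lp ℝ 2 π) :
    ‖martingaleDiff hc T g‖ ^ 2 ≤ 2 * dirichletForm T g := by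
  have h1 := integral_congr_ae ((martingaleDiff_ae_eq hc T g 0).fun_comp fun x => x ^ 2)
  simp only [Function.comp_apply] at h1
  rw [norm_sq_eq_integral_comp (hc.measurePreserving_pair 0), h1, hT.integral_past_sq]
  exact norm_sq_sub_norm_sq_le_dirichletForm T g

lemma condExp_martingaleDiff [IsFiniteMeasure P]
    (hc : IsStationaryReversibleMarkovChain P ξ hξ π Q)
    {T : Lp ℝ 2 π →L[ℝ] Lp ℝ 2 π} (hT : IsTransitionOperator P ξ hξ π T) (g : Lp ℝ 2 π) (n : ℤ) :
    P[fun ω => martingaleDiff hc T g (ξ n ω, ξ (n + 1) ω) | pastFiltration ξ hξ n] =ᵐ[P] 0 :=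
  (condExp_congr_ae (martingaleDiff_ae_eq hc T g n)).trans (hT.condExp_sub_past n g)

lemma coeFn_sub_pair (hc : IsStationaryReversibleMarkovChain P ξ hξ π Q)
    (u v : Lp ℝ 2 (pairLaw P ξ)) (n : ℤ) :
    (fun ω => (u - v : Lp ℝ 2 (pairLaw P ξ)) (ξ n ω, ξ (n + 1) ω))
      =ᵐ[P] (fun ω => u (ξ n ω, ξ (n + 1) ω)) - fun ω => v (ξ n ω, ξ (n + 1) ω) :=
  (hc.measurePreserving_pair n).quasiMeasurePreserving.ae_eq_comp (Lp.coeFn_sub u v)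

lemma condExp_sub_pair [IsFiniteMeasure P] (hc : IsStationaryReversibleMarkovChain P ξ hξ π Q)
    (u v : Lp ℝ 2 (pairLaw P ξ)) (n : ℤ)
    (hv : P[fun ω => v (ξ n ω, ξ (n + 1) ω) | pastFiltration ξ hξ n] =ᵐ[P] 0) :
    P[fun ω => (u - v : Lp ℝ 2 (pairLaw P ξ)) (ξ n ω, ξ (n + 1) ω) | pastFiltration ξ hξ n]
      =ᵐ[P] P[fun ω => u (ξ n ω, ξ (n + 1) ω) | pastFiltration ξ hξ n] := by
  refine (condExp_congr_ae (coeFn_sub_pair hc u v n)).trans ((condExp_sub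
    ((memLp_comp (hc.measurePreserving_pair n) u).integrable one_le_two)
    ((memLp_comp (hc.measurePreserving_pair n) v).integrable one_le_two) _).trans ?_)
  filter_upwards [hv] with ω h
  rw [Pi.sub_apply, h, Pi.zero_apply, sub_zero]

/-- `L²` limits of martingale differences are martingale differences. -/
lemma condExp_pair_eq_zero_of_tendsto [IsFiniteMeasure P]
    (hc : IsStationaryReversibleMarkovChain P ξ hξ π Q) {v : ℕ → Lp ℝ 2 (pairLaw P ξ)}
    {u : Lp ℝ 2 (pairLaw P ξ)} (hvu : Tendsto v atTop (𝓝 u)) (n : ℤ)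
    (hv : ∀ k, P[fun ω => v k (ξ n ω, ξ (n + 1) ω) | pastFiltration ξ hξ n] =ᵐ[P] 0) :
    P[fun ω => u (ξ n ω, ξ (n + 1) ω) | pastFiltration ξ hξ n] =ᵐ[P] 0 := by
  set D := P[fun ω => u (ξ n ω, ξ (n + 1) ω) | pastFiltration ξ hξ n] with hD
  have h1 : ∀ k, eLpNorm D 2 P ≤ ENNReal.ofReal ‖v k - u‖ := by
    intro k
    -- Subtracting `v k` leaves the conditional expectation unchanged, and conditioning contracts
    -- the `L²` norm.
    rw [← eLpNorm_congr_ae (condExp_sub_pair hc u (v k) n (hv k))]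
    refine (eLpNorm_condExp_le_eLpNorm _ one_le_two).trans_eq ?_
    have h2 := eLpNorm_comp_measurePreserving (p := 2)
      (Lp.aestronglyMeasurable (u - v k)) (hc.measurePreserving_pair n)
    rw [norm_sub_rev, Lp.norm_def, ENNReal.ofReal_toReal (Lp.eLpNorm_ne_top _)]
    exact h2
  have h3 : Tendsto (fun k => ENNReal.ofReal ‖v k - u‖) atTop (𝓝 0) := by
    simpa using ENNReal.tendsto_ofReal (tendsto_iff_norm_sub_tendsto_zero.1 hvu)
  have h4 : eLpNorm D 2 P = 0 := le_antisymm (ge_of_tendsto' h3 h1) zero_le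
  exact (eLpNorm_eq_zero_iff integrable_condExp.aestronglyMeasurable (by norm_num)).1 h4

lemma stronglyMeasurable_pair (hξ : ∀ n, Measurable (ξ n)) (u : Lp ℝ 2 (pairLaw P ξ)) (n : ℤ) :
    StronglyMeasurable[pastFiltration ξ hξ (n + 1)] fun ω => u (ξ n ω, ξ (n + 1) ω) :=
  (Lp.stronglyMeasurable u).comp_measurable
    ((measurable_pastFiltration hξ (by omega)).prodMk (measurable_pastFiltration hξ le_rfl))

lemma maxSq_sum_pair_le [IsFiniteMeasure P] (hc : IsStationaryReversibleMarkovChain P ξ hξ π Q)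
    (u : Lp ℝ 2 (pairLaw P ξ))
    (hu : ∀ n : ℤ, P[fun ω => u (ξ n ω, ξ (n + 1) ω) | pastFiltration ξ hξ n] =ᵐ[P] 0) (n : ℕ) :
    maxSq P (fun j ω => ∑ i ∈ Finset.range j, u (ξ (i : ℤ) ω, ξ ((i : ℤ) + 1) ω)) n
      ≤ ENNReal.ofReal (4 * ((n + 1) * ‖u‖ ^ 2)) := by
  refine (maxSq_sum_le (pastFiltrationNat ξ hξ) (n := n)
    (d := fun (i : ℕ) ω => u (ξ (i : ℤ) ω, ξ ((i : ℤ) + 1) ω)) (c := ‖u‖ ^ 2)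
    (fun k _ => memLp_comp (hc.measurePreserving_pair k) u)
    (fun k _ => stronglyMeasurable_pair hξ u k) (fun k _ => hu k)
    (fun k _ => (norm_sq_eq_integral_comp (hc.measurePreserving_pair k) u).ge)).trans
    (ENNReal.ofReal_le_ofReal ?_)
  gcongr
  linarith

/-- Stationarity of a functional of consecutive states. -/
lemma IsStationaryReversibleMarkovChain.isStationarySeq_pair
    (hc : IsStationaryReversibleMarkovChain P ξ hξ π Q) {φ : S × S → ℝ} (hφ : Measurable φ) :
    IsStationarySeq P fun k ω => (ξ k ω, φ (ξ k ω, ξ (k + 1) ω)) := by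
  intro k
  have hG : Measurable fun (x : ℤ → S) (n : ℤ) => (x n, φ (x n, x (n + 1))) := by
    refine measurable_pi_lambda _ fun n => ?_
    exact (measurable_pi_apply n).prodMk
      (hφ.comp ((measurable_pi_apply n).prodMk (measurable_pi_apply (n + 1))))
  have h1 := (hc.stationary k).comp hG
  have h2 : ∀ n : ℤ, n + 1 + k = n + k + 1 := fun n => by ring
  simpa [Function.comp_def, h2] using h1

lemma martingale_partialSum_pair [IsFiniteMeasure P]
    (hc : IsStationaryReversibleMarkovChain P ξ hξ π Q) (u : Lp ℝ 2 (pairLaw P ξ))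
    (hu : ∀ n : ℤ, P[fun ω => u (ξ n ω, ξ (n + 1) ω) | pastFiltration ξ hξ n] =ᵐ[P] 0) :
    Martingale (partialSum fun k ω => u (ξ k ω, ξ (k + 1) ω)) (pastFiltrationNat ξ hξ) P := by
  set D : ℤ → Ω → ℝ := fun k ω => u (ξ k ω, ξ (k + 1) ω) with hD
  have hDi : ∀ k, Integrable (D k) P := fun k =>
    (memLp_comp (hc.measurePreserving_pair k) u).integrable one_le_two
  have hint : ∀ n, Integrable (partialSum D n) P := fun n =>
    integrable_finsetSum _ fun i _ => hDi i
  -- `D i` looks one step ahead, to `ξ (i + 1)`; for `i < n` this is still known at time `n`.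
  have hadp : ∀ n : ℕ, StronglyMeasurable[pastFiltrationNat ξ hξ n] (partialSum D n) := fun n =>
    Finset.stronglyMeasurable_fun_sum _ fun i hi =>
      (stronglyMeasurable_pair hξ u i).mono ((pastFiltration ξ hξ).mono (by
        have := Finset.mem_range.1 hi; omega))
  refine martingale_nat hadp hint fun n => ?_
  have h1 : partialSum D (n + 1) = partialSum D n + D n := by
    ext ω; simp [partialSum, Finset.sum_range_succ]
  rw [h1]
  have h2 := condExp_add (hint n) (hDi n) (pastFiltrationNat ξ hξ n)
  have h3 := condExp_of_stronglyMeasurable ((pastFiltrationNat ξ hξ).le n) (hadp n) (hint n)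
  rw [h3] at h2
  filter_upwards [h2, hu n] with ω h4 h5
  rw [h4, Pi.add_apply]
  have h6 : (P[D n | pastFiltrationNat ξ hξ n]) ω = 0 := h5
  rw [h6, add_zero]

end Approximation

/-! ### From maximal bounds to the normalized limit, and assembly. -/

section Main

open scoped ENNReal InnerProductSpace

variable {Ω S : Type*} {mΩ : MeasurableSpace Ω} [mS : MeasurableSpace S] {P : Measure Ω}
  {Q : Kernel S S} {ξ : ℤ → Ω → S} {hξ : ∀ n, Measurable (ξ n)} {π : Measure S}

lemma integral_iSup_sq_le_toReal_maxSq (Y : ℕ → Ω → ℝ) (n : ℕ) (h : maxSq P Y n ≠ ∞) :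
    ∫ ω, ⨆ j : Finset.Icc 1 n, Y j ω ^ 2 ∂P ≤ (maxSq P Y n).toReal := by
  have h0 : ∀ ω, 0 ≤ ⨆ j : Finset.Icc 1 n, Y j ω ^ 2 := fun ω =>
    Real.iSup_nonneg fun j => sq_nonneg _
  by_cases hm : AEStronglyMeasurable (fun ω => ⨆ j : Finset.Icc 1 n, Y j ω ^ 2) P
  · rw [integral_eq_lintegral_of_nonneg_ae (ae_of_all _ h0) hm]
    refine ENNReal.toReal_mono h (lintegral_mono fun ω => ?_)
    -- For `n = 0` the real supremum is over an empty type and equals 0.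
    rcases isEmpty_or_nonempty (Finset.Icc 1 n) with he | he
    · simp [Real.iSup_of_isEmpty]
    · obtain ⟨j, hj⟩ := exists_eq_ciSup_of_finite (f := fun j : Finset.Icc 1 n => Y j ω ^ 2)
      rw [← hj]
      refine le_trans (le_of_eq ?_) (enorm_sq_le_iSup (Finset.mem_Icc.1 j.2).2 ω)
      rw [← sq_abs, ENNReal.ofReal_pow (abs_nonneg _), Real.enorm_eq_ofReal_abs]
  · rw [integral_undef fun hi => hm hi.1]
    exact ENNReal.toReal_nonneg

lemma tendsto_integral_iSup_sq_div {Y : ℕ → Ω → ℝ}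
    (h : ∀ δ > 0, ∃ C, 0 ≤ C ∧ ∀ n : ℕ, maxSq P Y n ≤ ENNReal.ofReal (C + δ * (n + 1))) :
    Tendsto (fun n : ℕ => (∫ ω, ⨆ j : Finset.Icc 1 n, Y j ω ^ 2 ∂P) / (n : ℝ)) atTop (𝓝 0) := by
  have h0 : ∀ n : ℕ, 0 ≤ (∫ ω, ⨆ j : Finset.Icc 1 n, Y j ω ^ 2 ∂P) / (n : ℝ) := fun n =>
    div_nonneg (integral_nonneg fun ω => Real.iSup_nonneg fun j => sq_nonneg _) n.cast_nonneg
  rw [Metric.tendsto_atTop]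
  intro ε hε
  obtain ⟨C, hC0, hC⟩ := h (ε / 4) (by positivity)
  obtain ⟨N, hN⟩ := exists_nat_gt (C / (ε / 4))
  refine ⟨N + 1, fun n hn => ?_⟩
  rw [Real.dist_0_eq_abs, abs_of_nonneg (h0 n)]
  have hn1 : (1 : ℝ) ≤ n := by exact_mod_cast (by omega : 1 ≤ n)
  have hnN : (N : ℝ) ≤ n := by exact_mod_cast (by omega : N ≤ n)
  have h1 := (integral_iSup_sq_le_toReal_maxSq Y n
    (ne_top_of_le_ne_top ENNReal.ofReal_ne_top (hC n))).trans
    (ENNReal.toReal_mono ENNReal.ofReal_ne_top (hC n))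
  rw [ENNReal.toReal_ofReal (by positivity)] at h1
  rw [div_lt_iff₀ (by positivity)] at hN ⊢
  nlinarith

/-- Since the sums are centred, their variance is a squared `L²` norm, and a convergent sequence is
bounded. The quotient says nothing at `n = 0`, where the sum is empty. -/
lemma exists_norm_sum_compL2_sq_le [IsProbabilityMeasure P]
    (hmp : ∀ n, MeasurePreserving (ξ n) P π) {f : S → ℝ} (hf : MemLp f 2 π)
    (hf0 : ∫ x, f x ∂π = 0) {sigmaSq : ℝ}
    (hvar : Tendsto
      (fun n : ℕ => variance (partialSum (fun i ω => f (ξ i ω)) n) P / (n : ℝ))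
      atTop (𝓝 sigmaSq)) :
    ∃ C : ℝ, ∀ n : ℕ, ‖∑ i ∈ Finset.range n, compL2 (hmp i) (hf.toLp f)‖ ^ 2 ≤ C * n := by
  have hint : ∀ i : ℤ, ∫ ω, f (ξ i ω) ∂P = 0 := fun i => by
    rw [← integral_map (hmp i).measurable.aemeasurable
      (by rw [(hmp i).map_eq]; exact hf.aestronglyMeasurable), (hmp i).map_eq, hf0]
  have hfi : ∀ i : ℤ, Integrable (fun ω => f (ξ i ω)) P := fun i =>
    (hf.comp_measurePreserving (hmp i)).integrable one_le_two
  have hae : ∀ n : ℕ, partialSum (fun i ω => f (ξ i ω)) n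
      =ᵐ[P] ((∑ i ∈ Finset.range n, compL2 (hmp i) (hf.toLp f) : Lp ℝ 2 P) : Ω → ℝ) := fun n => by
    refine EventuallyEq.trans ?_ (sum_compL2_ae_eq hmp (hf.toLp f) n)
    filter_upwards [ae_all_iff.2 fun i : ℕ =>
      (hmp i).quasiMeasurePreserving.ae_eq_comp hf.coeFn_toLp] with ω hω
    exact Finset.sum_congr rfl fun i _ => (hω i).symm
  have hV : ∀ n : ℕ, variance (partialSum (fun i ω => f (ξ i ω)) n) P
      = ‖∑ i ∈ Finset.range n, compL2 (hmp i) (hf.toLp f)‖ ^ 2 := by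
    intro n
    have h0 : ∫ ω, partialSum (fun i ω => f (ξ i ω)) n ω ∂P = 0 := by
      simp only [partialSum]
      rw [integral_finsetSum (f := fun (i : ℕ) ω => f (ξ i ω)) _ fun i _ => hfi i]
      exact Finset.sum_eq_zero fun i _ => hint i
    rw [variance_of_integral_eq_zero ((Lp.aestronglyMeasurable _).aemeasurable.congr (hae n).symm)
      h0, ← real_inner_self_eq_norm_sq, inner_eq_integral_mul]
    refine integral_congr_ae ?_
    filter_upwards [hae n] with ω hω
    rw [hω, sq]
  obtain ⟨C, hC⟩ := hvar.bddAbove_range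
  refine ⟨C, fun n => ?_⟩
  rcases Nat.eq_zero_or_pos n with rfl | hn
  · simp
  · have h1 := hC ⟨n, rfl⟩
    simp only at h1
    rwa [hV, div_le_iff₀ (by exact_mod_cast hn)] at h1

end Main

theorem mainTheorem9 {Ω S : Type*} {mΩ : MeasurableSpace Ω} [MeasurableSpace S]
    (P : Measure Ω) [IsProbabilityMeasure P]
    (π : Measure S) (Q : Kernel S S) [IsMarkovKernel Q]
    (ξ : ℤ → Ω → S) (hξ : ∀ n, Measurable (ξ n))
    (hchain : IsStationaryReversibleMarkovChain P ξ hξ π Q)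
    (f : S → ℝ) (hf : MemLp f 2 π) (hf0 : ∫ x, f x ∂π = 0)
    (sigmaSq : ℝ)
    (hvar : Tendsto
      (fun n : ℕ => variance (partialSum (fun i ω => f (ξ i ω)) n) P / (n : ℝ))
      atTop (𝓝 sigmaSq)) :
    HasMaximalMartingaleApproximation P ξ hξ (fun i ω => f (ξ i ω)) := by
  obtain ⟨T, hT⟩ := hchain.exists_isTransitionOperator
  have hmp := hT.measurePreserving
  obtain ⟨C, hC⟩ := exists_norm_sum_compL2_sq_le hmp hf hf0 hvar
  obtain ⟨K, hK⟩ := exists_le_dirichletForm_of_norm_sum_sq_le hT.symm hT.norm_le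
    (fun i : ℕ => compL2 (hmp i)) (fun i j hij g h => by
      rw [inner_compL2, inner_compL2]
      push_cast
      exact hT.integral_mul_comp_of_le (by exact_mod_cast hij) g h) hC
  obtain ⟨g, hg, hgE⟩ := exists_seq_tendsto_sub_of_le_dirichletForm hT.symm hT.norm_le hK
  have hcauchy : CauchySeq fun k => martingaleDiff hchain T (g k) := by
    rw [Metric.cauchySeq_iff]
    intro ε hε
    obtain ⟨N, hN⟩ := hgE (ε ^ 2 / 4) (by positivity)
    refine ⟨N, fun k hk l hl => ?_⟩
    rw [dist_eq_norm, ← map_sub]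
    have h1 := norm_martingaleDiff_sq_le hchain hT (g k - g l)
    have h2 := hN k hk l hl
    exact lt_of_pow_lt_pow_left₀ 2 hε.le (by nlinarith [sq_pos_of_pos hε])
  obtain ⟨u, hu⟩ := cauchySeq_tendsto_of_complete hcauchy
  have hcond : ∀ n : ℤ, P[fun ω => u (ξ n ω, ξ (n + 1) ω) | pastFiltration ξ hξ n] =ᵐ[P] 0 :=
    fun n => condExp_pair_eq_zero_of_tendsto hchain hu n
      fun k => condExp_martingaleDiff hchain hT (g k) n
  refine ⟨fun k ω => u (ξ k ω, ξ (k + 1) ω),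
    fun k => memLp_comp (hchain.measurePreserving_pair k) u,
    hchain.isStationarySeq_pair (Lp.stronglyMeasurable u).measurable,
    martingale_partialSum_pair hchain u hcond, ?_⟩
  refine tendsto_integral_iSup_sq_div (Y := fun j ω => partialSum (fun i ω => f (ξ i ω)) j ω
    - partialSum (fun k ω => u (ξ k ω, ξ (k + 1) ω)) j ω) fun δ hδ => ?_
  -- With η = `δ / 736`, the three error terms contribute 2·352 η (n + 1), 16 A + 16 η (n + 1) and
  -- 16 η (n + 1), and 704 + 16 + 16 = 736.
  obtain ⟨N, hN⟩ := hgE (δ / 736) (by positivity)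
  have hlim : Tendsto (fun k => ‖martingaleDiff hchain T (g k) - u‖ ^ 2) atTop (𝓝 0) := by
    simpa using (tendsto_iff_norm_sub_tendsto_zero.1 hu).pow 2
  obtain ⟨k, hkN, hk⟩ := ((eventually_ge_atTop N).and
    (hlim.eventually (gt_mem_nhds (show 0 < δ / 736 by positivity)))).exists
  obtain ⟨A, hA0, hA⟩ := exists_maxSq_comp_le hmp (g k) (show 0 < δ / 736 by positivity)
  refine ⟨16 * A, by positivity, fun n => ?_⟩
  set v := martingaleDiff hchain T (g k) with hv
  have b1 := hT.maxSq_sum_sub_le_of_tendsto hg (hN k hkN) n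
  have b2 : maxSq P (fun j ω => g k (ξ 0 ω) - g k (ξ (j : ℤ) ω)) n
      ≤ ENNReal.ofReal (4 * (A + δ / 736 * (n + 1))) :=
    maxSq_sub_le_ofReal (hA n) (ae_of_all _ fun ω j hj => ⟨0, by omega, j, hj, rfl⟩)
  have b3 := maxSq_sum_pair_le hchain (v - u) (fun i =>
    (condExp_sub_pair hchain v u i (hcond i)).trans (condExp_martingaleDiff hchain hT (g k) i)) n
  have b4 := maxSq_add_le_ofReal (W := fun j ω => (g k (ξ 0 ω) - g k (ξ (j : ℤ) ω))
      + ∑ i ∈ Finset.range j, (v - u : Lp ℝ 2 (pairLaw P ξ)) (ξ (i : ℤ) ω, ξ ((i : ℤ) + 1) ω))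
    (fun j => (((Lp.stronglyMeasurable (g k)).measurable.comp (hξ 0)).sub
      ((Lp.stronglyMeasurable (g k)).measurable.comp (hξ j))).aemeasurable) b2 b3
    (by positivity) (by positivity) (ae_of_all _ fun ω j _ => rfl)
  refine (maxSq_add_le_ofReal (fun j => (measurable_sum_comp hmp _ j).aemeasurable) b1 b4
    (by positivity) (by positivity) ?_).trans (ENNReal.ofReal_le_ofReal ?_)
  · have e1 : ∀ᵐ ω ∂P, ∀ i : ℕ, (hf.toLp f : Lp ℝ 2 π) (ξ i ω) = f (ξ i ω) := ae_all_iff.2 fun i =>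
      (hmp i).quasiMeasurePreserving.ae_eq_comp hf.coeFn_toLp
    have e2 : ∀ᵐ ω ∂P, ∀ i : ℕ, (hf.toLp f - (g k - T (g k)) : Lp ℝ 2 π) (ξ i ω)
        = (hf.toLp f : Lp ℝ 2 π) (ξ i ω) - (g k - T (g k) : Lp ℝ 2 π) (ξ i ω) := ae_all_iff.2 fun i =>
      (hmp i).quasiMeasurePreserving.ae_eq_comp (Lp.coeFn_sub (hf.toLp f) (g k - T (g k)))
    have e3 : ∀ᵐ ω ∂P, ∀ i : ℕ, (g k - T (g k) : Lp ℝ 2 π) (ξ i ω)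
        = g k (ξ i ω) - T (g k) (ξ i ω) := ae_all_iff.2 fun i =>
      (hmp i).quasiMeasurePreserving.ae_eq_comp (Lp.coeFn_sub (g k) (T (g k)))
    filter_upwards [e1, e2, e3, ae_all_iff.2 fun i : ℕ => coeFn_sub_pair hchain v u i,
      ae_all_iff.2 fun i : ℕ => martingaleDiff_ae_eq hchain T (g k) i]
      with ω h1 h2 h3 h4 h5 j hj
    clear hj
    have h6 : ∀ i : ℕ, (v - u : Lp ℝ 2 (pairLaw P ξ)) (ξ i ω, ξ (i + 1) ω)
        = g k (ξ (i + 1) ω) - T (g k) (ξ i ω) - u (ξ i ω, ξ (i + 1) ω) := fun i => by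
      rw [h4, Pi.sub_apply, ← h5]
    simp only [partialSum, h1, h2, h3, h6]
    -- The identity telescopes: each step replaces `g k (ξ j)` by `g k (ξ (j + 1))` in the boundary
    -- term.
    induction j with
    | zero => simp
    | succ j ih =>
      simp only [Finset.sum_range_succ]
      push_cast
      linarith
  · have h1 : (n + 1 : ℝ) * ‖v - u‖ ^ 2 ≤ (n + 1) * (δ / 736) := by gcongr
    linarith
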